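/- Let $X_1,X_2,\dots$ be independent with $\mathbb P(X_i=1)=\mathbb P(X_i=-1)=\tfrac12$ and let $RW_k=X_1+\cdots+X_k$, $RW_0=0$, be the simple symmetric random walk. For $n\ge 0$ let $SW(n)$ be the set of walks $w=(w(0),\dots,w(n))$ of integers with $w(0)=0$ and increments $\pm1$. For a set $A\subset SW(n)$ of patterns of length $n$, let $$T(A)=\inf\{k+n:\ k\ge 0,\ (RW_{k+i}-RW_k)_{0\le i\le n}\in A\}$$ be the waiting time until a pattern of $A$ has been observed in the walk. For $\lambda\in\mathbb R$ let $\lambda_n=\lfloor\lambda\sqrt n\rfloor$ if $\lfloor\lambda\sqrt n\rfloor$ and $n$ have the same parity, and $\lambda_n=\lfloor\lambda\sqrt n\rfloor+1$ otherwise. Put $$\mathcal E^{2n}=\{w\in SW(2n):\ w(i)>0\text{ for }1\le i\le 2n-1,\ w(2n)=0\},$$ $$\mathcal M^{2n+1}=\{w\in SW(2n+1):\ w(i)>0\text{ for }1\le i\le 2n+1\},$$ $$\mathcal{BR}^{\lambda,n}=\{w\in SW(n):\ w(n)=\lambda_n\},$$ $$\mathcal{FP}^{\lambda,n}=\{w\in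 SW(n):\ w(i)>w(n)=\lambda_n\text{ for }0\le i\le n-1\}.$$ Theorem 1.5. As $n\to\infty$: 1. $\mathbb E T(\mathcal E^{2n})\sim 4\sqrt\pi\,n^{3/2}$. 2. $\mathbb E T(\mathcal M^{2n+1})\sim 4n$. 3. For every $\lambda\in\mathbb R$ there are constants $c,C>0$, depending only on $\lambda$, such that $c\,n\le\mathbb E T(\mathcal{BR}^{\lambda,n})\le C\,n$ for all sufficiently large $n$. 4. For every $\lambda<0$ there are constants $c,C>0$, depending only on $\lambda$, such that $c\,n\le\mathbb E T(\mathcal{FP}^{\lambda,n})\le C\,n^{5/4}$ for all sufficiently large $n$. -/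

import Mathlib

open MeasureTheory Filter Topology Asymptotics
open scoped ENNReal

/-- The law of one step of the simple symmetric random walk: `+1` or `-1`, each with
probability `1/2`. -/
noncomputable def stepLaw : Measure ℤ :=
  (2⁻¹ : ℝ≥0∞) • Measure.dirac (1 : ℤ) + (2⁻¹ : ℝ≥0∞) • Measure.dirac (-1 : ℤ)

instance stepLaw_isProbabilityMeasure : IsProbabilityMeasure stepLaw :=
  ⟨by simp [stepLaw, ENNReal.inv_two_add_inv_two]⟩

/-- The law of an infinite sequence of independent steps `X 0, X 1, X 2, …`, each with law
`stepLaw`: a probability measure on `ℕ → ℤ`. -/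
noncomputable def stepsLaw : Measure (ℕ → ℤ) :=
  Measure.infinitePi (fun _ : ℕ => stepLaw)

/-- The walk `RW k = X 0 + ⋯ + X (k - 1)`, started at `RW 0 = 0`. -/
def randomWalk (X : ℕ → ℤ) (k : ℕ) : ℤ := ∑ i ∈ Finset.range k, X i

/-- The piece of the walk seen through the time window `[k, k + n]`, translated so as to start at
the origin: `(RW (k + i) - RW k; 0 ≤ i ≤ n)`. -/
def window (n : ℕ) (X : ℕ → ℤ) (k : ℕ) : Fin (n + 1) → ℤ :=
  fun i => randomWalk X (k + i) - randomWalk X k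

/-- The waiting time `T(A)` of a collection `A` of patterns of length `n`: the first time at which
the last `n` steps of the walk form a pattern of `A`, and `⊤` if this never happens. -/
noncomputable def waitingTime {n : ℕ} (A : Set (Fin (n + 1) → ℤ)) (X : ℕ → ℤ) : ℕ∞ :=
  ⨅ (k : ℕ) (_ : window n X k ∈ A), ((k + n : ℕ) : ℕ∞)

/-- The expected waiting time `𝔼 T(A)`, possibly infinite. -/
noncomputable def expectedWaitingTime {n : ℕ} (A : Set (Fin (n + 1) → ℤ)) : ℝ≥0∞ :=
  ∫⁻ X, (waitingTime A X : ℝ≥0∞) ∂stepsLaw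

/-- `SW n`: walks of length `n` with increments `±1` starting at `0`. -/
def SW (n : ℕ) : Set (Fin (n + 1) → ℤ) :=
  {w | w 0 = 0 ∧
    ∀ i : Fin n, w i.succ - w i.castSucc = 1 ∨ w i.succ - w i.castSucc = -1}

/-- Positive excursions of length `2n`, whose first return to `0` is at time `2n`. -/
def excursions (n : ℕ) : Set (Fin (2 * n + 1) → ℤ) :=
  {w | w ∈ SW (2 * n) ∧ (∀ i, 0 < i → i < Fin.last (2 * n) → 0 < w i) ∧
    w (Fin.last (2 * n)) = 0}

/-- Positive walks of length `2n + 1`. -/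
def positiveWalks (n : ℕ) : Set (Fin (2 * n + 1 + 1) → ℤ) :=
  {w | w ∈ SW (2 * n + 1) ∧ ∀ i, 0 < i → 0 < w i}

/-- The level `l_n`: the integer part of `l √n` if it has the same parity as `n`, and the next
integer otherwise. -/
noncomputable def level (l : ℝ) (n : ℕ) : ℤ :=
  if ⌊l * √(n : ℝ)⌋ ≡ (n : ℤ) [ZMOD 2] then ⌊l * √(n : ℝ)⌋ else ⌊l * √(n : ℝ)⌋ + 1

/-- Bridges of length `n` ending at `l_n`. -/
def bridges (l : ℝ) (n : ℕ) : Set (Fin (n + 1) → ℤ) :=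
  {w | w ∈ SW n ∧ w (Fin.last n) = level l n}

/-- First passage walks of length `n`: they reach `l_n` at time `n` and stay strictly above `l_n`
before. -/
def firstPassageWalks (l : ℝ) (n : ℕ) : Set (Fin (n + 1) → ℤ) :=
  {w | w ∈ SW n ∧ (∀ i, i < Fin.last n → w (Fin.last n) < w i) ∧
    w (Fin.last n) = level l n}

/-! The expected waiting time is the sum over `m` of the probability that no pattern is completed by
time `m` (`noHit`), and the four parts differ in how this sum is controlled.

For excursions and positive walks it is computed exactly by `hasSum_of_renewal`. Two excursions
cannot overlap, so an excursion started at `k` is the first one as soon as none was completed by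
time `k`; telescoping gives `1 / p`, with `p` the probability of the pattern. Positive walks do
overlap, but the first one starts at a weak running minimum. Splitting at the last weak minimum
gives `(∑ q i) / p`, with `q i` the probability of staying positive for `i` steps. All these
probabilities are expressed by the return probability `r m` at time `2m`, and Wallis' product gives
`r m ~ 1 / √(π m)`.

For bridges and first passage walks the lower bound is trivial, since `T ≥ n`. For the upper bound,
disjoint blocks of length `2n` are independent trials, so a success probability `c` per block gives
`𝔼 T ≤ 2n / c` (`expectedWaitingTime_le`). A block contains a bridge with probability bounded below:
the increment over a sliding window moves by `0` or `±2`, hence takes the value `level l n` if it is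
at most this on the first window and at least this on the next, disjoint one
(`walkAt_hit_of_crossing`, `exists_le_measureReal_tail`). For first passages the second moment
method is applied to the number of starting times `k < n`. The mean is bounded below, by the hitting
time identity `hitProb_eq` and the local bound `exists_le_walkProb`; the second moment is of order
at most `log n` by `measureReal_firstHit_overlap_le`. This yields `n log n`, which is weakened to `n
^ (5 / 4)`. -/

/-- The sequence `c, X 0, X 1, …`. -/
def consStep (c : ℤ) (X : ℕ → ℤ) : ℕ → ℤ
  | 0 => c
  | i + 1 => X i

/-- The sequence of steps after time `m`. -/
def shiftSteps (m : ℕ) (X : ℕ → ℤ) : ℕ → ℤ := fun i => X (m + i)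

/-- The event `G` depends only on the first `m` steps. -/
def UpTo (m : ℕ) (G : Set (ℕ → ℤ)) : Prop :=
  ∀ X Y : ℕ → ℤ, (∀ i < m, X i = Y i) → X ∈ G → Y ∈ G

/-- The step sequences all of whose entries are `±1`. -/
def signSteps : Set (ℕ → ℤ) := {X | ∀ i, X i = 1 ∨ X i = -1}

/-! ### Product structure of the step law: first step, independence, signs -/

instance stepsLaw_isProbabilityMeasure : IsProbabilityMeasure stepsLaw := by
  unfold stepsLaw; infer_instance

lemma measurable_consStep (c : ℤ) : Measurable (consStep c) := by
  refine measurable_pi_lambda _ fun i => ?_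
  cases i with
  | zero => exact measurable_const
  | succ i => exact measurable_pi_apply i

lemma measurable_shiftSteps (m : ℕ) : Measurable (shiftSteps m) :=
  measurable_pi_lambda _ fun i => measurable_pi_apply (m + i)

lemma stepsLaw_pi_range (K : ℕ) (t : ℕ → Set ℤ) :
    stepsLaw (Set.pi (Finset.range K : Finset ℕ) t) = ∏ i ∈ Finset.range K, stepLaw (t i) :=
  Measure.infinitePi_pi _ fun _ _ => MeasurableSet.of_discrete

lemma stepLaw_apply (t : Set ℤ) :
    stepLaw t = 2⁻¹ * t.indicator 1 1 + 2⁻¹ * t.indicator 1 (-1) := by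
  simp [stepLaw]

lemma consStep_preimage_pi (c : ℤ) (K : ℕ) (t : ℕ → Set ℤ) :
    stepsLaw (consStep c ⁻¹' Set.pi (Finset.range (K + 1) : Finset ℕ) t) =
      (t 0).indicator 1 c * ∏ i ∈ Finset.range K, stepLaw (t (i + 1)) := by
  rw [← stepsLaw_pi_range K fun i => t (i + 1)]
  by_cases hc : c ∈ t 0
  · simp only [hc, Set.indicator_of_mem, Pi.one_apply, one_mul]
    congr 1
    ext X
    simp only [Set.mem_preimage, Set.mem_pi, Finset.coe_range, Set.mem_Iio]
    constructor
    · intro h i hi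
      exact h (i + 1) (by omega)
    · rintro h (_ | i) hi
      · exact hc
      · exact h i (by omega)
  · simp only [hc, not_false_eq_true, Set.indicator_of_notMem, zero_mul]
    convert measure_empty (μ := stepsLaw)
    ext X
    simp only [Set.mem_preimage, Set.mem_pi, Finset.coe_range, Set.mem_Iio, Set.mem_empty_iff_false,
      iff_false]
    intro h
    exact hc (h 0 (by omega))

/-- A product measure is determined by its values on finite boxes, and on these the first factor
splits off. This is the source of every induction on the number of steps. -/
lemma stepsLaw_eq_cons : stepsLaw = (2⁻¹ : ℝ≥0∞) • stepsLaw.map (consStep 1) +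
    (2⁻¹ : ℝ≥0∞) • stepsLaw.map (consStep (-1)) := by
  symm
  refine Measure.eq_infinitePi _ fun s t _ => ?_
  obtain ⟨K, hK⟩ : ∃ K, s ⊆ Finset.range (K + 1) :=
    ⟨s.sup id, fun i hi => by
      have : i ≤ s.sup id := Finset.le_sup (f := id) hi
      simp; omega⟩
  classical
  -- Padding with `Set.univ` turns the index set into an initial segment containing `0`.
  set t' : ℕ → Set ℤ := fun i => if i ∈ s then t i else Set.univ with ht'
  have hset : Set.pi (s : Set ℕ) t = Set.pi (Finset.range (K + 1) : Finset ℕ) t' := by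
    ext X
    simp only [Set.mem_pi, Finset.mem_coe, ht']
    constructor
    · intro h i _
      by_cases hi : i ∈ s <;> simp [hi, h]
    · intro h i hi
      simpa [hi] using h i (hK hi)
  have hprod : ∏ i ∈ s, stepLaw (t i) = ∏ i ∈ Finset.range (K + 1), stepLaw (t' i) := by
    rw [← Finset.prod_subset hK]
    · refine Finset.prod_congr rfl fun i hi => by simp [ht', hi]
    · intro i _ hi
      simp [ht', hi]
  have hm : MeasurableSet (Set.pi (Finset.range (K + 1) : Finset ℕ) t') :=
    MeasurableSet.pi (Finset.countable_toSet _) fun _ _ => MeasurableSet.of_discrete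
  rw [hset, hprod, Finset.prod_range_succ']
  simp only [Measure.coe_add, Measure.coe_smul, Pi.add_apply, Pi.smul_apply, smul_eq_mul]
  rw [Measure.map_apply (measurable_consStep _) hm, Measure.map_apply (measurable_consStep _) hm,
    consStep_preimage_pi, consStep_preimage_pi, stepLaw_apply (t' 0)]
  ring

/-- Decomposition according to the first step. -/
lemma measureReal_firstStep {E : Set (ℕ → ℤ)} (hE : MeasurableSet E) :
    stepsLaw.real E =
      (stepsLaw.real (consStep 1 ⁻¹' E) + stepsLaw.real (consStep (-1) ⁻¹' E)) / 2 := by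
  have h : stepsLaw E = 2⁻¹ * stepsLaw (consStep 1 ⁻¹' E) +
      2⁻¹ * stepsLaw (consStep (-1) ⁻¹' E) := by
    conv_lhs => rw [stepsLaw_eq_cons]
    simp only [Measure.coe_add, Measure.coe_smul, Pi.add_apply, Pi.smul_apply, smul_eq_mul]
    rw [Measure.map_apply (measurable_consStep _) hE, Measure.map_apply (measurable_consStep _) hE]
  simp only [Measure.real, h]
  rw [ENNReal.toReal_add (by finiteness) (by finiteness)]
  simp
  ring

/-- Such an event is pulled back from the countable space `Fin m → ℤ`, where every set is
measurable. -/
lemma UpTo.measurableSet {m : ℕ} {G : Set (ℕ → ℤ)} (h : UpTo m G) : MeasurableSet G := by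
  let r : (ℕ → ℤ) → (Fin m → ℤ) := fun X i => X i
  have hr : Measurable r := measurable_pi_lambda _ fun i => measurable_pi_apply _
  have : G = r ⁻¹' (r '' G) := by
    refine (Set.subset_preimage_image r G).antisymm ?_
    rintro Y ⟨X, hX, hXY⟩
    exact h X Y (fun i hi => congrFun hXY ⟨i, hi⟩) hX
  rw [this]
  exact hr (Set.to_countable _).measurableSet

lemma UpTo.inter {m : ℕ} {G H : Set (ℕ → ℤ)} (hG : UpTo m G) (hH : UpTo m H) : UpTo m (G ∩ H) :=
  fun X Y hXY h => ⟨hG X Y hXY h.1, hH X Y hXY h.2⟩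

lemma UpTo.shift {m : ℕ} {G : Set (ℕ → ℤ)} (h : UpTo m G) (k : ℕ) :
    UpTo (k + m) (shiftSteps k ⁻¹' G) :=
  fun X Y hXY hX => h (shiftSteps k X) (shiftSteps k Y) (fun i hi => hXY (k + i) (by omega)) hX

/-- The past up to time `m` and the future after time `m` are independent. -/
lemma UpTo.measureReal_inter_shift {m : ℕ} {G B : Set (ℕ → ℤ)} (hG : UpTo m G)
    (hB : MeasurableSet B) :
    stepsLaw.real (G ∩ shiftSteps m ⁻¹' B) = stepsLaw.real G * stepsLaw.real B := by
  induction m generalizing G with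
  | zero =>
    have h0 : shiftSteps 0 ⁻¹' B = B := by
      ext X
      have : shiftSteps 0 X = X := funext fun i => by simp [shiftSteps]
      simp [this]
    rw [h0]
    rcases G.eq_empty_or_nonempty with rfl | ⟨X, hX⟩
    · simp
    · have : G = Set.univ := Set.eq_univ_of_forall fun Y => hG X Y (by simp) hX
      simp [this]
  | succ m ih =>
    have key (c : ℤ) : stepsLaw.real (consStep c ⁻¹' (G ∩ shiftSteps (m + 1) ⁻¹' B)) =
        stepsLaw.real (consStep c ⁻¹' G) * stepsLaw.real B := by
      rw [← ih (G := consStep c ⁻¹' G)]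
      · congr 1
        ext X
        have : shiftSteps (m + 1) (consStep c X) = shiftSteps m X := by
          ext i
          simp only [shiftSteps]
          rw [show m + 1 + i = (m + i) + 1 by ring]
          rfl
        simp [this]
      · intro X Y hXY hX
        refine hG _ _ ?_ hX
        rintro (_ | i) hi
        · rfl
        · exact hXY i (by omega)
    rw [measureReal_firstStep (hG.measurableSet.inter (measurable_shiftSteps _ hB)),
      measureReal_firstStep hG.measurableSet, key, key]
    ring

lemma measureReal_shift (m : ℕ) {B : Set (ℕ → ℤ)} (hB : MeasurableSet B) :
    stepsLaw.real (shiftSteps m ⁻¹' B) = stepsLaw.real B := by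
  have h := UpTo.measureReal_inter_shift (m := m) (G := Set.univ) (fun _ _ _ h => h) hB
  simpa using h

lemma ae_signSteps : ∀ᵐ X ∂stepsLaw, X ∈ signSteps := by
  refine ae_all_iff.2 fun i => ?_
  have h : ∀ᵐ x ∂stepLaw, x = 1 ∨ x = -1 := by
    rw [ae_iff, stepLaw_apply]
    simp
  have h2 : Measure.map (fun X : ℕ → ℤ => X i) stepsLaw = stepLaw :=
    Measure.infinitePi_map_eval _ i
  rw [← h2] at h
  exact ae_of_ae_map (measurable_pi_apply i).aemeasurable h

/-- Step sequences are arbitrary integer sequences here; path arguments need `±1` steps, which hold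
almost surely. -/
lemma measureReal_congr_signSteps {E F : Set (ℕ → ℤ)}
    (h : ∀ X ∈ signSteps, X ∈ E ↔ X ∈ F) : stepsLaw.real E = stepsLaw.real F := by
  refine measureReal_congr ?_
  filter_upwards [ae_signSteps] with X hX
  exact propext (h X hX)

lemma measureReal_mono_signSteps {E F : Set (ℕ → ℤ)}
    (h : ∀ X ∈ signSteps, X ∈ E → X ∈ F) : stepsLaw.real E ≤ stepsLaw.real F := by
  refine ENNReal.toReal_mono (by finiteness) (measure_mono_ae ?_)
  filter_upwards [ae_signSteps] with X hX
  exact h X hX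

/-! ### The walk -/

lemma randomWalk_zero (X : ℕ → ℤ) : randomWalk X 0 = 0 := by simp [randomWalk]

lemma randomWalk_succ (X : ℕ → ℤ) (k : ℕ) : randomWalk X (k + 1) = randomWalk X k + X k := by
  simp [randomWalk, Finset.sum_range_succ]

lemma randomWalk_cons (c : ℤ) (X : ℕ → ℤ) (k : ℕ) :
    randomWalk (consStep c X) (k + 1) = c + randomWalk X k := by
  rw [randomWalk, Finset.sum_range_succ', add_comm]
  rfl

lemma randomWalk_shift (m : ℕ) (X : ℕ → ℤ) (k : ℕ) :
    randomWalk (shiftSteps m X) k = randomWalk X (m + k) - randomWalk X m := by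
  rw [randomWalk, randomWalk, randomWalk, Finset.sum_range_add]
  simp [shiftSteps]

lemma randomWalk_congr {m : ℕ} {X Y : ℕ → ℤ} (h : ∀ i < m, X i = Y i) {k : ℕ} (hk : k ≤ m) :
    randomWalk X k = randomWalk Y k :=
  Finset.sum_congr rfl fun i hi => h i (by have := Finset.mem_range.1 hi; omega)

lemma window_eq_shift (n : ℕ) (X : ℕ → ℤ) (k : ℕ) :
    window n X k = window n (shiftSteps k X) 0 := by
  ext i
  simp [window, randomWalk_shift, randomWalk_zero]

lemma window_zero_mem_SW (n : ℕ) {X : ℕ → ℤ} (hX : X ∈ signSteps) : window n X 0 ∈ SW n := by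
  refine ⟨by simp [window], fun i => ?_⟩
  have := hX i
  simpa [window, randomWalk_zero, randomWalk_succ] using this

lemma shiftSteps_mem_signSteps {X : ℕ → ℤ} (hX : X ∈ signSteps) (k : ℕ) :
    shiftSteps k X ∈ signSteps := fun i => hX (k + i)

lemma randomWalk_step {X : ℕ → ℤ} (hX : X ∈ signSteps) (k : ℕ) :
    randomWalk X (k + 1) = randomWalk X k + 1 ∨ randomWalk X (k + 1) = randomWalk X k - 1 := by
  rw [randomWalk_succ]
  rcases hX k with h | h <;> simp [h, sub_eq_add_neg]

lemma randomWalk_bounds {X : ℕ → ℤ} (hX : X ∈ signSteps) (k : ℕ) :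
    -(k : ℤ) ≤ randomWalk X k ∧ randomWalk X k ≤ k := by
  induction k with
  | zero => simp [randomWalk_zero]
  | succ k ih =>
    rcases randomWalk_step hX k with h | h <;> rw [h] <;> push_cast <;> omega

lemma randomWalk_parity {X : ℕ → ℤ} (hX : X ∈ signSteps) (k : ℕ) :
    randomWalk X k ≡ (k : ℤ) [ZMOD 2] := by
  induction k with
  | zero => simp [randomWalk_zero]
  | succ k ih =>
    unfold Int.ModEq at *
    rcases randomWalk_step hX k with h | h <;> rw [h] <;> push_cast <;> omega

/-! ### Waiting times -/

/-- No occurrence of `B`, an event about `N` steps, is completed by time `m`. -/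
def noHit (B : Set (ℕ → ℤ)) (N m : ℕ) : Set (ℕ → ℤ) :=
  {X | ∀ k, k + N ≤ m → shiftSteps k X ∉ B}

lemma noHit_antitone (B : Set (ℕ → ℤ)) (N : ℕ) : Antitone (noHit B N) :=
  fun _ _ h _ hX k hk => hX k (hk.trans h)

lemma noHit_eq_univ (B : Set (ℕ → ℤ)) {N m : ℕ} (h : m < N) : noHit B N m = Set.univ :=
  Set.eq_univ_of_forall fun _ k hk => absurd hk (by omega)

lemma UpTo.noHit {B : Set (ℕ → ℤ)} {N : ℕ} (hB : UpTo N B) (m : ℕ) : UpTo m (noHit B N m) :=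
  fun X Y hXY hX k hk hY =>
    hX k hk ((hB.shift k) Y X (fun i hi => (hXY i (by omega)).symm) hY)

lemma ENat.toENNReal_eq_tsum (t : ℕ∞) :
    (t : ℝ≥0∞) = ∑' m : ℕ, if (m : ℕ∞) < t then (1 : ℝ≥0∞) else 0 := by
  induction t using ENat.recTopCoe with
  | top => simp
  | coe n =>
    rw [tsum_eq_sum (s := Finset.range n)]
    · rw [Finset.sum_congr rfl (g := fun _ => 1)]
      · simp
      · intro i hi
        simp [Finset.mem_range.1 hi]
    · intro i hi
      have : ¬ i < n := by simpa using hi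
      simp [this]

lemma lt_waitingTime_iff {n : ℕ} (A : Set (Fin (n + 1) → ℤ)) (X : ℕ → ℤ) (m : ℕ) :
    (m : ℕ∞) < waitingTime A X ↔ ∀ k, k + n ≤ m → window n X k ∉ A := by
  constructor
  · intro h k hk hA
    have : waitingTime A X ≤ ((k + n : ℕ) : ℕ∞) := iInf₂_le k hA
    exact absurd (h.trans_le this) (not_lt.2 (by exact_mod_cast hk))
  · intro h
    have : ((m + 1 : ℕ) : ℕ∞) ≤ waitingTime A X := by
      refine le_iInf₂ fun k hk => ?_
      have : ¬ k + n ≤ m := fun h' => h k h' hk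
      exact_mod_cast (by omega : m + 1 ≤ k + n)
    refine lt_of_lt_of_le ?_ this
    exact_mod_cast Nat.lt_succ_self m

/-- Tail formula for the expected waiting time. -/
lemma expectedWaitingTime_eq_tsum {n : ℕ} {A : Set (Fin (n + 1) → ℤ)} {B : Set (ℕ → ℤ)}
    (hB : UpTo n B) (hAB : ∀ X ∈ signSteps, window n X 0 ∈ A ↔ X ∈ B) :
    expectedWaitingTime A = ∑' m, ENNReal.ofReal (stepsLaw.real (noHit B n m)) := by
  have h : expectedWaitingTime A =
      ∫⁻ X, ∑' m : ℕ, (noHit B n m).indicator 1 X ∂stepsLaw := by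
    refine lintegral_congr_ae ?_
    filter_upwards [ae_signSteps] with X hX
    rw [ENat.toENNReal_eq_tsum]
    refine tsum_congr fun m => ?_
    have : (m : ℕ∞) < waitingTime A X ↔ X ∈ noHit B n m := by
      rw [lt_waitingTime_iff]
      refine forall₂_congr fun k _ => ?_
      rw [window_eq_shift, hAB _ (shiftSteps_mem_signSteps hX k)]
    by_cases h : X ∈ noHit B n m <;> simp [this, h]
  rw [h, lintegral_tsum fun m => (measurable_one.indicator (hB.noHit m).measurableSet).aemeasurable]
  refine tsum_congr fun m => ?_
  rw [lintegral_indicator_one (hB.noHit m).measurableSet, ofReal_measureReal]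

lemma le_expectedWaitingTime {n : ℕ} (A : Set (Fin (n + 1) → ℤ)) :
    (n : ℝ≥0∞) ≤ expectedWaitingTime A := by
  have h : ∀ X, (n : ℝ≥0∞) ≤ (waitingTime A X : ℝ≥0∞) := fun X => by
    have : (n : ℕ∞) ≤ waitingTime A X :=
      le_iInf₂ fun k _ => by exact_mod_cast Nat.le_add_left n k
    simpa using ENat.toENNReal_le.2 this
  calc (n : ℝ≥0∞) = ∫⁻ _, (n : ℝ≥0∞) ∂stepsLaw := by simp
    _ ≤ _ := lintegral_mono h

/-! ### One-dimensional distributions: symmetry, parity, unimodality -/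

/-- The probability that the simple random walk is at `x` at time `n`. -/
noncomputable def walkProb : ℕ → ℤ → ℝ
  | 0, x => if x = 0 then 1 else 0
  | n + 1, x => (walkProb n (x - 1) + walkProb n (x + 1)) / 2

/-- The probability that the simple random walk visits `-x` for the first time at time `n`. -/
noncomputable def hitProb : ℕ → ℤ → ℝ
  | 0, x => if x = 0 then 1 else 0
  | n + 1, x => if 0 < x then (walkProb n (x - 1) - walkProb n (x + 1)) / 2 else 0

lemma walkProb_zero_left (x : ℤ) : walkProb 0 x = if x = 0 then 1 else 0 := rfl

lemma walkProb_succ (n : ℕ) (x : ℤ) :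
    walkProb (n + 1) x = (walkProb n (x - 1) + walkProb n (x + 1)) / 2 := rfl

lemma hitProb_zero_left (x : ℤ) : hitProb 0 x = if x = 0 then 1 else 0 := rfl

lemma hitProb_succ_of_pos (n : ℕ) {x : ℤ} (hx : 0 < x) :
    hitProb (n + 1) x = (walkProb n (x - 1) - walkProb n (x + 1)) / 2 := if_pos hx

lemma hitProb_succ_of_nonpos (n : ℕ) {x : ℤ} (hx : ¬ 0 < x) : hitProb (n + 1) x = 0 := if_neg hx

/-- The probability of being at `0` at time `2 m`. -/
noncomputable def returnProb (m : ℕ) : ℝ := walkProb (2 * m) 0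

lemma walkProb_nonneg (n : ℕ) (x : ℤ) : 0 ≤ walkProb n x := by
  induction n generalizing x with
  | zero => rw [walkProb_zero_left]; split_ifs <;> norm_num
  | succ n ih => rw [walkProb_succ]; linarith [ih (x - 1), ih (x + 1)]

lemma walkProb_neg (n : ℕ) (x : ℤ) : walkProb n (-x) = walkProb n x := by
  induction n generalizing x with
  | zero => simp [walkProb]
  | succ n ih =>
    unfold walkProb
    rw [← ih (x - 1), ← ih (x + 1), show -(x - 1) = -x + 1 by ring, show -(x + 1) = -x - 1 by ring]
    ring

lemma walkProb_eq_zero_of_parity {n : ℕ} {x : ℤ} (h : ¬ x ≡ (n : ℤ) [ZMOD 2]) :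
    walkProb n x = 0 := by
  unfold Int.ModEq at h
  induction n generalizing x with
  | zero =>
    have : x ≠ 0 := by rintro rfl; simp at h
    simp [walkProb, this]
  | succ n ih =>
    unfold walkProb
    push_cast at h
    rw [ih (by omega), ih (by omega)]
    norm_num

lemma sum_walkProb_le_one (n : ℕ) (s : Finset ℤ) : ∑ x ∈ s, walkProb n x ≤ 1 := by
  induction n generalizing s with
  | zero =>
    simp only [walkProb, Finset.sum_ite_eq']
    split_ifs <;> norm_num
  | succ n ih =>
    have h1 := ih (s.map (Equiv.subRight (1 : ℤ)).toEmbedding)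
    have h2 := ih (s.map (Equiv.addRight (1 : ℤ)).toEmbedding)
    simp only [Finset.sum_map, Equiv.coe_toEmbedding, Equiv.subRight_apply,
      Equiv.coe_addRight] at h1 h2
    simp only [walkProb]
    rw [← Finset.sum_div, Finset.sum_add_distrib]
    linarith

/-- The ratio of neighbouring binomial coefficients, without division and for every integer `x`; it
propagates linearly through the recursion. Unimodality, the hitting time identity and the local
lower bound all rest on it. -/
lemma walkProb_ratio (n : ℕ) (x : ℤ) :
    ((n : ℝ) + x + 2) * walkProb n (x + 2) = (n - x) * walkProb n x := by
  induction n generalizing x with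
  | zero =>
    unfold walkProb
    by_cases h0 : x = 0
    · simp [h0]
    · by_cases h2 : x = -2
      · simp [h2]
      · simp [h0, show x + 2 ≠ 0 by omega]
  | succ n ih =>
    have h1 := ih (x - 1)
    have h2 := ih (x + 1)
    rw [show x - 1 + 2 = x + 1 by ring] at h1
    rw [show x + 1 + 2 = x + 3 by ring] at h2
    unfold walkProb
    rw [show x + 2 - 1 = x + 1 by ring, show x + 2 + 1 = x + 3 by ring]
    push_cast at *
    linear_combination (1 / 2) * h2 + (1 / 2) * h1

lemma walkProb_add_two_le (n : ℕ) {x : ℤ} (hx : 0 ≤ x) : walkProb n (x + 2) ≤ walkProb n x := by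
  have hx' : (0 : ℝ) ≤ x := by exact_mod_cast hx
  have h := walkProb_ratio n x
  have h0 := walkProb_nonneg n x
  have hpos : (0 : ℝ) < n + x + 2 := by positivity
  refine le_of_mul_le_mul_left ?_ hpos
  rw [h]
  exact mul_le_mul_of_nonneg_right (by linarith) h0

lemma walkProb_add_even_le (n : ℕ) {x : ℤ} (hx : 0 ≤ x) (k : ℕ) :
    walkProb n (x + 2 * k) ≤ walkProb n x := by
  induction k with
  | zero => simp
  | succ k ih =>
    refine le_trans ?_ ih
    have := walkProb_add_two_le n (x := x + 2 * k) (by positivity)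
    rwa [show x + 2 * ((k + 1 : ℕ) : ℤ) = x + 2 * k + 2 by push_cast; ring]

lemma walkProb_le_of_abs_le (n : ℕ) {x y : ℤ} (hxy : |y| ≤ |x|) (hp : x ≡ y [ZMOD 2]) :
    walkProb n x ≤ walkProb n y := by
  have habs (z : ℤ) : walkProb n |z| = walkProb n z := by
    rcases abs_choice z with h | h <;> rw [h]
    exact walkProb_neg n z
  rw [← habs x, ← habs y]
  obtain ⟨k, hk⟩ : ∃ k : ℕ, |x| = |y| + 2 * k := by
    refine ⟨((|x| - |y|) / 2).toNat, ?_⟩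
    unfold Int.ModEq at hp
    rcases abs_choice x with h | h <;> rcases abs_choice y with h' | h' <;> omega
  rw [hk]
  exact walkProb_add_even_le n (abs_nonneg y) k

/-- By unimodality the `x + 1` sites `x, x - 2, …, -x` are each at least as likely as `x`. -/
lemma mul_walkProb_le_one (n : ℕ) {x : ℤ} (hx : 0 ≤ x) : x * walkProb n x ≤ 1 := by
  obtain ⟨k, rfl⟩ := Int.eq_ofNat_of_zero_le hx
  have hinj : Function.Injective fun i : ℕ => ((k : ℤ) - 2 * i) := fun i j h => by
    simp only at h; omega
  have h := sum_walkProb_le_one n ((Finset.range (k + 1)).map ⟨_, hinj⟩)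
  rw [Finset.sum_map] at h
  have h2 : ∑ _i ∈ Finset.range (k + 1), walkProb n k ≤
      ∑ i ∈ Finset.range (k + 1), walkProb n ((k : ℤ) - 2 * i) := by
    refine Finset.sum_le_sum fun i hi => walkProb_le_of_abs_le n ?_ ?_
    · have := Finset.mem_range.1 hi
      rw [abs_le, abs_of_nonneg hx]
      omega
    · unfold Int.ModEq
      omega
  simp only [Finset.sum_const, Finset.card_range, nsmul_eq_mul] at h2
  have h0 := walkProb_nonneg n k
  have h3 : ((k + 1 : ℕ) : ℝ) * walkProb n k ≤ 1 := h2.trans h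
  push_cast at *
  linarith

/-! ### Return probabilities -/

lemma returnProb_zero : returnProb 0 = 1 := by simp [returnProb, walkProb]

lemma walkProb_two_mul_add_one_one (m : ℕ) : walkProb (2 * m + 1) 1 = returnProb (m + 1) := by
  rw [returnProb, show 2 * (m + 1) = 2 * m + 1 + 1 by ring, walkProb_succ (2 * m + 1) 0]
  rw [zero_sub, zero_add, walkProb_neg]
  ring

lemma walkProb_two_mul_two (m : ℕ) : (m + 1) * walkProb (2 * m) 2 = m * returnProb m := by
  have h := walkProb_ratio (2 * m) 0
  push_cast at h
  rw [returnProb]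
  norm_num at h
  linarith

lemma returnProb_succ (m : ℕ) :
    (2 * m + 2) * returnProb (m + 1) = (2 * m + 1) * returnProb m := by
  have h := walkProb_two_mul_two m
  rw [← walkProb_two_mul_add_one_one, walkProb_succ]
  norm_num
  change (2 * (m : ℝ) + 2) * ((returnProb m + _) / 2) = _
  linarith

lemma returnProb_pos (m : ℕ) : 0 < returnProb m := by
  induction m with
  | zero => simp [returnProb_zero]
  | succ m ih =>
    have h := returnProb_succ m
    have h2 : 0 < (2 * (m : ℝ) + 2) * returnProb (m + 1) := by rw [h]; positivity
    exact pos_of_mul_pos_right h2 (by positivity)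

/-- The successive ratios of `returnProb m ^ 2 * (2 * m + 1)` are the inverses of the Wallis
factors. -/
lemma returnProb_sq_mul_wallis (m : ℕ) : returnProb m ^ 2 * (2 * m + 1) * Real.Wallis.W m = 1 := by
  induction m with
  | zero => simp [returnProb_zero, Real.Wallis.W]
  | succ m ih =>
    have h : returnProb (m + 1) = (2 * m + 1) / (2 * m + 2) * returnProb m := by
      rw [div_mul_eq_mul_div, eq_div_iff (by positivity), ← returnProb_succ]
      ring
    rw [Real.Wallis.W_succ, h]
    refine Eq.trans ?_ ih
    push_cast
    field_simp
    ring

lemma returnProb_sq_le (m : ℕ) : returnProb m ^ 2 * (2 * m + 1) ≤ 1 := by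
  induction m with
  | zero => simp [returnProb_zero]
  | succ m ih =>
    have h : returnProb (m + 1) = (2 * m + 1) / (2 * m + 2) * returnProb m := by
      rw [div_mul_eq_mul_div, eq_div_iff (by positivity), ← returnProb_succ]
      ring
    refine le_trans ?_ ih
    have e : returnProb (m + 1) ^ 2 * (2 * ((m + 1 : ℕ) : ℝ) + 1) =
        returnProb m ^ 2 * (2 * m + 1) * ((2 * m + 1) * (2 * m + 3) / (2 * m + 2) ^ 2) := by
      rw [h]; push_cast; field_simp; ring
    rw [e]
    refine mul_le_of_le_one_right (by positivity) ?_
    rw [div_le_one (by positivity)]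
    nlinarith

lemma le_returnProb_sq {m : ℕ} (hm : 1 ≤ m) : 1 ≤ returnProb m ^ 2 * (4 * m) := by
  induction m, hm using Nat.le_induction with
  | base =>
    have h := returnProb_succ 0
    simp only [returnProb_zero, Nat.cast_zero, zero_add, mul_zero] at h
    have : returnProb 1 = 1 / 2 := by linarith
    rw [this]; norm_num
  | succ m hm ih =>
    have hm' : (1 : ℝ) ≤ m := by exact_mod_cast hm
    have h : returnProb (m + 1) = (2 * m + 1) / (2 * m + 2) * returnProb m := by
      rw [div_mul_eq_mul_div, eq_div_iff (by positivity), ← returnProb_succ]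
      ring
    refine ih.trans ?_
    have e : returnProb (m + 1) ^ 2 * (4 * ((m + 1 : ℕ) : ℝ)) =
        returnProb m ^ 2 * (4 * m) * ((2 * m + 1) ^ 2 / (4 * m * (m + 1))) := by
      rw [h]; push_cast; field_simp; ring
    rw [e]
    refine le_mul_of_one_le_right (by positivity) ?_
    rw [one_le_div (by positivity)]
    nlinarith

lemma tendsto_returnProb_mul_sqrt :
    Tendsto (fun m : ℕ => returnProb m * √(2 * m + 1)) atTop (𝓝 (√(2 / Real.pi))) := by
  have h : (fun m : ℕ => returnProb m * √(2 * m + 1)) = fun m => √((Real.Wallis.W m)⁻¹) := by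
    ext m
    have hW := Real.Wallis.W_pos m
    rw [eq_comm, Real.sqrt_eq_iff_mul_self_eq (by positivity)
      (mul_nonneg (returnProb_pos m).le (Real.sqrt_nonneg _))]
    have hs : √(2 * (m : ℝ) + 1) * √(2 * (m : ℝ) + 1) = 2 * m + 1 :=
      Real.mul_self_sqrt (by positivity)
    have h1 := returnProb_sq_mul_wallis m
    symm
    apply eq_inv_of_mul_eq_one_left
    rw [mul_mul_mul_comm, hs, ← sq]
    exact h1
  rw [h]
  have := (Real.Wallis.tendsto_W_nhds_pi_div_two.inv₀ (by positivity)).sqrt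
  simpa using this

/-- Unimodality reduces to the site `0` or `1` of the right parity, where the value is a return
probability. -/
lemma walkProb_le (n : ℕ) (x : ℤ) : walkProb n x ≤ 1 / √(n + 1) := by
  have hr (m : ℕ) : returnProb m ≤ 1 / √(2 * m + 1) := by
    rw [le_div_iff₀ (by positivity)]
    refine (abs_le_one_iff_mul_self_le_one.2 ?_) |> le_trans (le_abs_self _)
    have hs : √(2 * (m : ℝ) + 1) * √(2 * (m : ℝ) + 1) = 2 * m + 1 :=
      Real.mul_self_sqrt (by positivity)
    nlinarith [returnProb_sq_le m]
  by_cases hp : x ≡ (n : ℤ) [ZMOD 2]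
  · obtain ⟨m, rfl | rfl⟩ := Nat.even_or_odd' n
    · refine (walkProb_le_of_abs_le _ (y := 0) (by simp) ?_).trans ?_
      · unfold Int.ModEq at *; push_cast at hp; omega
      · simpa [returnProb] using hr m
    · refine (walkProb_le_of_abs_le _ (y := 1) ?_ ?_).trans ?_
      · unfold Int.ModEq at *
        push_cast at hp
        have : x ≠ 0 := by rintro rfl; omega
        simpa using Int.one_le_abs this
      · unfold Int.ModEq at *; push_cast at hp; omega
      · rw [walkProb_two_mul_add_one_one]
        refine (hr (m + 1)).trans ?_
        push_cast
        gcongr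
        linarith
  · rw [walkProb_eq_zero_of_parity hp]
    positivity

/-! ### First passage probabilities -/

lemma hitProb_of_nonpos {n : ℕ} (hn : n ≠ 0) {x : ℤ} (hx : x ≤ 0) : hitProb n x = 0 := by
  obtain ⟨n, rfl⟩ := Nat.exists_eq_succ_of_ne_zero hn
  simp [hitProb, hx]

/-- The closed form of `hitProb` comes from reflection; this recursion is what identifies it with a
first passage probability. At `x = 1` the absorbing boundary value is supplied by the symmetry of
`walkProb`. -/
lemma hitProb_succ (n : ℕ) {x : ℤ} (hx : 0 < x) :
    hitProb (n + 1) x = (hitProb n (x - 1) + hitProb n (x + 1)) / 2 := by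
  cases n with
  | zero =>
    rw [hitProb_succ_of_pos _ hx, hitProb_zero_left, hitProb_zero_left, walkProb_zero_left,
      walkProb_zero_left, if_neg (by omega : x + 1 ≠ 0)]
    ring
  | succ n =>
    rw [hitProb_succ_of_pos _ hx, hitProb_succ_of_pos _ (by omega : 0 < x + 1), walkProb_succ,
      walkProb_succ]
    by_cases h1 : 0 < x - 1
    · rw [hitProb_succ_of_pos _ h1]
      ring_nf
    · obtain rfl : x = 1 := by omega
      have := walkProb_neg n 1
      rw [hitProb_succ_of_nonpos _ h1]
      norm_num at this ⊢
      linarith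

/-- The hitting time theorem, read off from `walkProb_ratio` at `x - 1`. -/
lemma hitProb_eq (n : ℕ) {x : ℤ} (hx : 0 ≤ x) : n * hitProb n x = x * walkProb n x := by
  cases n with
  | zero =>
    by_cases h : x = 0 <;> simp [walkProb_zero_left, h]
  | succ n =>
    rcases hx.eq_or_lt with rfl | hx
    · simp [hitProb]
    · rw [hitProb_succ_of_pos _ hx, walkProb_succ]
      have h := walkProb_ratio n (x - 1)
      rw [show x - 1 + 2 = x + 1 by ring] at h
      push_cast at *
      linarith

lemma hitProb_nonneg (n : ℕ) (x : ℤ) : 0 ≤ hitProb n x := by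
  cases n with
  | zero => rw [hitProb_zero_left]; split_ifs <;> norm_num
  | succ n =>
    by_cases hx : 0 < x
    · rw [hitProb_succ_of_pos _ hx]
      have := walkProb_add_two_le n (x := x - 1) (by omega)
      rw [show x - 1 + 2 = x + 1 by ring] at this
      linarith
    · rw [hitProb_succ_of_nonpos _ hx]

lemma hitProb_le {n : ℕ} (hn : n ≠ 0) (x : ℤ) : hitProb n x ≤ 1 / n := by
  rcases le_or_gt x 0 with hx | hx
  · rw [hitProb_of_nonpos hn hx]
    positivity
  · have hn' : (0 : ℝ) < n := by positivity
    rw [le_div_iff₀ hn', mul_comm, hitProb_eq n hx.le]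
    exact mul_walkProb_le_one n hx.le

/-- Only positive `x` contribute, and there the differences telescope in steps of two, leaving the
values of `walkProb` at `0` and `1`. -/
lemma sum_hitProb_le {n : ℕ} (hn : n ≠ 0) (s : Finset ℤ) :
    ∑ x ∈ s, hitProb n x ≤ 1 / √n := by
  obtain ⟨n, rfl⟩ := Nat.exists_eq_succ_of_ne_zero hn
  obtain ⟨K, hK⟩ : ∃ K : ℕ, ∀ x ∈ s, x ≤ K :=
    ⟨s.sup Int.toNat, fun x hx => by
      have : Int.toNat x ≤ s.sup Int.toNat := Finset.le_sup hx
      omega⟩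
  have hinj : Function.Injective fun i : ℕ => ((i : ℤ) + 1) := fun i j h => by
    simp only at h; omega
  have h1 : ∑ x ∈ s, hitProb (n + 1) x ≤
      ∑ x ∈ (Finset.range K).map ⟨_, hinj⟩, hitProb (n + 1) x := by
    rw [← Finset.sum_filter_add_sum_filter_not s (fun x : ℤ => 0 < x)]
    rw [Finset.sum_eq_zero (s := s.filter fun x => ¬ 0 < x)]
    · rw [add_zero]
      refine Finset.sum_le_sum_of_subset_of_nonneg ?_ fun _ _ _ => hitProb_nonneg _ _
      intro x hx
      rw [Finset.mem_filter] at hx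
      have := hK x hx.1
      simp only [Finset.mem_map, Finset.mem_range, Function.Embedding.coeFn_mk]
      exact ⟨(x - 1).toNat, by omega, by omega⟩
    · intro x hx
      rw [Finset.mem_filter] at hx
      exact hitProb_of_nonpos (by omega) (by omega)
  have h2 (k : ℕ) : ∑ i ∈ Finset.range k, hitProb (n + 1) ((i : ℤ) + 1) =
      (walkProb n 0 + walkProb n 1 - walkProb n k - walkProb n (k + 1)) / 2 := by
    induction k with
    | zero => simp
    | succ k ih =>
      rw [Finset.sum_range_succ, ih, hitProb_succ_of_pos _ (by positivity)]
      push_cast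
      ring_nf
  refine h1.trans ?_
  rw [Finset.sum_map]
  simp only [Function.Embedding.coeFn_mk]
  rw [h2]
  have := walkProb_le n 0
  have := walkProb_le n 1
  have := walkProb_nonneg n K
  have := walkProb_nonneg n (K + 1)
  push_cast
  linarith

/-! ### Path events and their probabilities -/

/-- The walk is positive at the times `1, …, n`. -/
def positiveUpTo (n : ℕ) : Set (ℕ → ℤ) := {X | ∀ i, 0 < i → i ≤ n → 0 < randomWalk X i}

/-- The walk visits `-x` for the first time at time `n`, not having been below `-x` before. -/
def firstHit (n : ℕ) (x : ℤ) : Set (ℕ → ℤ) :=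
  {X | randomWalk X n = -x ∧ ∀ i < n, -x < randomWalk X i}

/-- The walk is at `x` at time `n`. -/
def walkAt (n : ℕ) (x : ℤ) : Set (ℕ → ℤ) := {X | randomWalk X n = x}

/-- The walk is nonnegative up to time `n`. -/
def nonnegUpTo (n : ℕ) : Set (ℕ → ℤ) := {X | ∀ i ≤ n, 0 ≤ randomWalk X i}

lemma upTo_positiveUpTo (n : ℕ) : UpTo n (positiveUpTo n) := fun X Y h hX i h0 hi => by
  rw [← randomWalk_congr h hi]; exact hX i h0 hi

lemma upTo_walkAt (n : ℕ) (x : ℤ) : UpTo n (walkAt n x) := fun X Y h hX => by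
  rw [walkAt, Set.mem_ofPred_eq, ← randomWalk_congr h le_rfl]; exact hX

lemma upTo_firstHit (n : ℕ) (x : ℤ) : UpTo n (firstHit n x) := fun X Y h hX => by
  refine ⟨?_, fun i hi => ?_⟩
  · rw [← randomWalk_congr h le_rfl]; exact hX.1
  · rw [← randomWalk_congr h hi.le]; exact hX.2 i hi

lemma measureReal_walkAt (n : ℕ) (x : ℤ) : stepsLaw.real (walkAt n x) = walkProb n x := by
  induction n generalizing x with
  | zero =>
    rw [walkProb_zero_left]
    by_cases h : x = 0
    · have : walkAt 0 x = Set.univ := Set.eq_univ_of_forall fun X => by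
        simp [walkAt, randomWalk_zero, h]
      rw [this, if_pos h, probReal_univ]
    · have : walkAt 0 x = ∅ := Set.eq_empty_of_forall_notMem fun X => by
        simp [walkAt, randomWalk_zero, Ne.symm h]
      rw [this, if_neg h, measureReal_empty]
  | succ n ih =>
    have key (c : ℤ) : consStep c ⁻¹' walkAt (n + 1) x = walkAt n (x - c) := by
      ext X
      simp only [walkAt, Set.mem_preimage, Set.mem_ofPred_eq, randomWalk_cons]
      omega
    rw [measureReal_firstStep (upTo_walkAt _ _).measurableSet, key, key, ih, ih, walkProb_succ,
      sub_neg_eq_add]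

lemma measureReal_firstHit (n : ℕ) (x : ℤ) : stepsLaw.real (firstHit n x) = hitProb n x := by
  induction n generalizing x with
  | zero =>
    rw [hitProb_zero_left]
    by_cases h : x = 0
    · have : firstHit 0 x = Set.univ := Set.eq_univ_of_forall fun X => by
        simp [firstHit, randomWalk_zero, h]
      rw [this, if_pos h, probReal_univ]
    · have : firstHit 0 x = ∅ := Set.eq_empty_of_forall_notMem fun X => by
        simp [firstHit, randomWalk_zero, h]
      rw [this, if_neg h, measureReal_empty]
  | succ n ih =>
    by_cases hx : 0 < x
    · have key (c : ℤ) : consStep c ⁻¹' firstHit (n + 1) x = firstHit n (x + c) := by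
        ext X
        simp only [firstHit, Set.mem_preimage, Set.mem_ofPred_eq, randomWalk_cons]
        refine and_congr (by omega) ⟨fun h i hi => ?_, ?_⟩
        · have := h (i + 1) (by omega)
          rw [randomWalk_cons] at this
          omega
        · rintro h (_ | i) hi
          · rw [randomWalk_zero]; omega
          · have := h i (by omega)
            rw [randomWalk_cons]
            omega
      rw [measureReal_firstStep (upTo_firstHit _ _).measurableSet, key, key, ih, ih,
        hitProb_succ n hx, ← sub_eq_add_neg]
      ring
    · have : firstHit (n + 1) x = ∅ := Set.eq_empty_of_forall_notMem fun X h => by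
        have := h.2 0 (by omega)
        rw [randomWalk_zero] at this
        omega
      rw [hitProb_of_nonpos (by omega) (by omega), this]
      simp

/-- A walk nonnegative up to `n` either stays so at `n + 1` or first visits `-1` at that time. -/
lemma measureReal_nonnegUpTo (n : ℕ) :
    stepsLaw.real (nonnegUpTo n) = walkProb n 0 + walkProb n 1 := by
  induction n with
  | zero =>
    have : nonnegUpTo 0 = Set.univ := Set.eq_univ_of_forall fun X i hi => by
      rw [Nat.le_zero.1 hi, randomWalk_zero]
    simp [this, walkProb_zero_left]
  | succ n ih =>
    have h : stepsLaw.real (nonnegUpTo n) =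
        stepsLaw.real (nonnegUpTo (n + 1) ∪ firstHit (n + 1) 1) := by
      refine measureReal_congr_signSteps fun X hX => ⟨fun h => ?_, ?_⟩
      · have h0 := h n le_rfl
        by_cases hn : 0 ≤ randomWalk X (n + 1)
        · left
          intro i hi
          rcases Nat.le_succ_iff.1 hi with hi | rfl
          · exact h i hi
          · exact hn
        · right
          refine ⟨?_, fun i hi => ?_⟩
          · rcases randomWalk_step hX n with h' | h' <;> omega
          · have := h i (by omega)
            omega
      · rintro (h | h) i hi
        · exact h i (by omega)
        · have := h.2 i (by omega)
          omega
    rw [measureReal_union _ (upTo_firstHit _ _).measurableSet, measureReal_firstHit, ih,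
      hitProb_succ_of_pos n one_pos] at h
    · have := walkProb_neg n 1
      simp only [walkProb_succ]
      norm_num at *
      linarith
    · refine Set.disjoint_left.2 fun X h h' => ?_
      have := h (n + 1) le_rfl
      rw [h'.1] at this
      omega

lemma measureReal_positiveUpTo_succ (n : ℕ) :
    stepsLaw.real (positiveUpTo (n + 1)) = (walkProb n 0 + walkProb n 1) / 2 := by
  have h1 : consStep 1 ⁻¹' positiveUpTo (n + 1) = nonnegUpTo n := by
    ext X
    constructor
    · intro h i hi
      have := h (i + 1) (by omega) (by omega)
      rw [randomWalk_cons] at this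
      omega
    · rintro h (_ | i) h0 hi
      · omega
      · have := h i (by omega)
        rw [randomWalk_cons]
        omega
  have h2 : consStep (-1) ⁻¹' positiveUpTo (n + 1) = ∅ :=
    Set.eq_empty_of_forall_notMem fun X h => by
      have := h 1 (by omega) (by omega)
      rw [show 1 = 0 + 1 by rfl, randomWalk_cons, randomWalk_zero] at this
      omega
  rw [measureReal_firstStep (upTo_positiveUpTo _).measurableSet, h1, h2, measureReal_nonnegUpTo]
  simp

lemma measureReal_positiveUpTo_odd (m : ℕ) :
    stepsLaw.real (positiveUpTo (2 * m + 1)) = returnProb m / 2 := by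
  rw [measureReal_positiveUpTo_succ, walkProb_eq_zero_of_parity (x := 1), returnProb]
  · ring
  · unfold Int.ModEq; push_cast; omega

lemma measureReal_positiveUpTo_even (m : ℕ) :
    stepsLaw.real (positiveUpTo (2 * m + 2)) = returnProb (m + 1) / 2 := by
  rw [measureReal_positiveUpTo_succ, walkProb_eq_zero_of_parity (x := 0),
    walkProb_two_mul_add_one_one]
  · ring
  · unfold Int.ModEq; push_cast; omega

lemma sum_measureReal_positiveUpTo (n : ℕ) :
    ∑ i ∈ Finset.range (2 * n + 1), stepsLaw.real (positiveUpTo i) =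
      1 / 2 + returnProb n / 2 + 2 * n * returnProb n := by
  induction n with
  | zero =>
    have : positiveUpTo 0 = Set.univ := Set.eq_univ_of_forall fun X i h0 hi => by omega
    simp [this, returnProb_zero]
    norm_num
  | succ n ih =>
    rw [show 2 * (n + 1) + 1 = 2 * n + 1 + 1 + 1 by ring, Finset.sum_range_succ,
      Finset.sum_range_succ, ih, measureReal_positiveUpTo_odd, measureReal_positiveUpTo_even]
    have := returnProb_succ n
    push_cast
    linarith

/-- The walk makes a positive excursion of length `n`. -/
def excursionUpTo (n : ℕ) : Set (ℕ → ℤ) :=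
  {X | (∀ i, 0 < i → i < n → 0 < randomWalk X i) ∧ randomWalk X n = 0}

lemma upTo_excursionUpTo (n : ℕ) : UpTo n (excursionUpTo n) := fun X Y h hX => by
  refine ⟨fun i h0 hi => ?_, ?_⟩
  · rw [← randomWalk_congr h hi.le]; exact hX.1 i h0 hi
  · rw [← randomWalk_congr h le_rfl]; exact hX.2

/-- An excursion is an up-step followed by a first passage to `-1` in `2 * m + 1` steps. -/
lemma measureReal_excursionUpTo (m : ℕ) :
    stepsLaw.real (excursionUpTo (2 * m + 2)) = returnProb m / (4 * (m + 1)) := by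
  have h1 : consStep 1 ⁻¹' excursionUpTo (2 * m + 2) = firstHit (2 * m + 1) 1 := by
    ext X
    constructor
    · intro h
      have h2 := h.2
      rw [randomWalk_cons] at h2
      refine ⟨by omega, fun i hi => ?_⟩
      have := h.1 (i + 1) (by omega) (by omega)
      rw [randomWalk_cons] at this
      omega
    · intro h
      refine ⟨?_, ?_⟩
      · rintro (_ | i) h0 hi
        · omega
        · have := h.2 i (by omega)
          rw [randomWalk_cons]
          omega
      · rw [randomWalk_cons, h.1]
        rfl
  have h2 : consStep (-1) ⁻¹' excursionUpTo (2 * m + 2) = ∅ :=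
    Set.eq_empty_of_forall_notMem fun X h => by
      have := h.1 1 (by omega) (by omega)
      rw [show 1 = 0 + 1 by rfl, randomWalk_cons, randomWalk_zero] at this
      omega
  rw [measureReal_firstStep (upTo_excursionUpTo _).measurableSet, h1, h2, measureReal_firstHit,
    hitProb_succ_of_pos _ one_pos]
  have h := walkProb_two_mul_two m
  norm_num
  rw [eq_div_iff (by positivity)]
  change ((returnProb m - _) / 2 / 2) * (4 * ((m : ℝ) + 1)) = _
  linarith

/-! ### Renewal identities -/

/-- If `t m` is the probability that no occurrence is completed by time `m`, and occurrences of
probability `p` start afresh at renewal times, then the expected waiting time `∑ t m` is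
`(∑ q i) / p`. -/
lemma hasSum_of_renewal {t g q : ℕ → ℝ} {p : ℝ} {N R : ℕ} (hp : 0 < p) (hN : 0 < N)
    (ht : ∀ m, 0 ≤ t m) (hg : ∀ m, 0 ≤ g m) (ht1 : ∀ m < N, t m = 1)
    (hgt : ∀ m, p * g m = t (m + N - 1) - t (m + N))
    (htg : ∀ m, t m = ∑ i ∈ Finset.range R, if i ≤ m then q i * g (m - i) else 0) :
    HasSum t ((∑ i ∈ Finset.range R, q i) / p) := by
  -- Telescoping of `hgt`, starting from `t (N - 1) = 1`.
  have hsum (M : ℕ) : p * ∑ m ∈ Finset.range M, g m = 1 - t (M + N - 1) := by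
    induction M with
    | zero => rw [ht1 _ (by omega)]; simp
    | succ M ih =>
      rw [Finset.sum_range_succ, mul_add, ih, hgt, show M + 1 + N - 1 = M + N by omega]
      ring
  have hgs : Summable g := by
    refine summable_of_sum_range_le (c := 1 / p) hg fun M => ?_
    rw [le_div_iff₀ hp, mul_comm, hsum]
    linarith [ht (M + N - 1)]
  have hshift (i : ℕ) : HasSum (fun m => if i ≤ m then q i * g (m - i) else 0)
      (q i * ∑' m, g m) := by
    rw [← hasSum_nat_add_iff' i]
    have h0 : ∑ m ∈ Finset.range i, (if i ≤ m then q i * g (m - i) else 0) = 0 :=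
      Finset.sum_eq_zero fun m hm => if_neg (by simpa using hm)
    rw [h0, sub_zero]
    simpa using hgs.hasSum.mul_left (q i)
  have hts : HasSum t (∑ i ∈ Finset.range R, q i * ∑' m, g m) := by
    have h := hasSum_sum (s := Finset.range R) fun i _ => hshift i
    convert h using 2 with m
    exact htg m
  -- Bounded partial sums of `g` already gave summability of `t`; hence `t` tends to `0` and the
  -- telescoped identity becomes `p * ∑ g = 1`.
  have ht0 : Tendsto (fun M => 1 - t (M + N - 1)) atTop (𝓝 (1 - 0)) := by
    refine tendsto_const_nhds.sub (hts.summable.tendsto_atTop_zero.comp ?_)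
    exact tendsto_atTop_mono (fun M => by rw [id]; omega) tendsto_id
  have hg1 : p * ∑' m, g m = 1 := by
    have h := hgs.hasSum.tendsto_sum_nat.const_mul p
    simp only [hsum] at h
    simpa using tendsto_nhds_unique h ht0
  rw [← Finset.sum_mul] at hts
  have hg2 : ∑' m, g m = 1 / p := eq_div_of_mul_eq hp.ne' (by linarith)
  rwa [hg2, mul_one_div] at hts

lemma expectedWaitingTime_eq_ofReal {n : ℕ} {A : Set (Fin (n + 1) → ℤ)} {B : Set (ℕ → ℤ)}
    (hB : UpTo n B) (hAB : ∀ X ∈ signSteps, window n X 0 ∈ A ↔ X ∈ B) {a : ℝ}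
    (h : HasSum (fun m => stepsLaw.real (noHit B n m)) a) :
    expectedWaitingTime A = ENNReal.ofReal a := by
  rw [expectedWaitingTime_eq_tsum hB hAB, ← h.tsum_eq,
    ENNReal.ofReal_tsum_of_nonneg (fun _ => measureReal_nonneg) h.summable]

lemma measureReal_diff_noHit {B : Set (ℕ → ℤ)} {N : ℕ} (hB : UpTo N B) (m : ℕ) :
    stepsLaw.real (noHit B N (m + N - 1) \ noHit B N (m + N)) =
      stepsLaw.real (noHit B N (m + N - 1)) - stepsLaw.real (noHit B N (m + N)) :=
  measureReal_sdiff (noHit_antitone B N (by omega)) (hB.noHit _).measurableSet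

/-! ### Excursions -/

/-- At time `j` the walk is above the base of the first excursion; at time `k + N` it is back at
that base, yet should be above its height at `j`. -/
lemma excursion_no_overlap {N : ℕ} {X : ℕ → ℤ} {k j : ℕ} (h1 : k < j) (h2 : j < k + N)
    (hk : shiftSteps k X ∈ excursionUpTo N) : shiftSteps j X ∉ excursionUpTo N := by
  intro hj
  have a := hk.1 (j - k) (by omega) (by omega)
  have b := hk.2
  have c := hj.1 (k + N - j) (by omega) (by omega)
  rw [randomWalk_shift] at a b c
  rw [show k + (j - k) = j by omega] at a
  rw [show j + (k + N - j) = k + N by omega] at c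
  omega

lemma hasSum_noHit_excursion (m : ℕ) :
    HasSum (fun k => stepsLaw.real (noHit (excursionUpTo (2 * m + 2)) (2 * m + 2) k))
      (4 * (m + 1) / returnProb m) := by
  set N := 2 * m + 2 with hN
  have hr := returnProb_pos m
  have h := hasSum_of_renewal (p := stepsLaw.real (excursionUpTo N)) (N := N) (R := 1)
    (t := fun k => stepsLaw.real (noHit (excursionUpTo N) N k))
    (g := fun k => stepsLaw.real (noHit (excursionUpTo N) N k)) (q := fun _ => 1)
    (by rw [measureReal_excursionUpTo]; positivity) (by omega) (fun _ => measureReal_nonneg)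
    (fun _ => measureReal_nonneg) (fun k hk => by simp [noHit_eq_univ _ hk]) ?_ (fun k => by simp)
  · convert h using 1
    rw [measureReal_excursionUpTo]
    simp
  · intro k
    have hB := upTo_excursionUpTo N
    rw [← measureReal_diff_noHit hB, mul_comm,
      ← (hB.noHit k).measureReal_inter_shift hB.measurableSet]
    congr 1
    ext X
    constructor
    · rintro ⟨h1, h2⟩
      refine ⟨fun j hj hX => ?_, fun h => h k le_rfl h2⟩
      by_cases hjk : j + N ≤ k
      · exact h1 j hjk hX
      · exact excursion_no_overlap (by omega) (by omega) hX h2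
    · rintro ⟨h1, h2⟩
      refine ⟨noHit_antitone _ _ (by omega) h1, ?_⟩
      by_contra h3
      refine h2 fun j hj hX => ?_
      rcases hj.lt_or_eq with hj | hj
      · exact h1 j (by omega) hX
      · obtain rfl : j = k := by omega
        exact h3 hX

lemma window_mem_excursions (n : ℕ) {X : ℕ → ℤ} (hX : X ∈ signSteps) :
    window (2 * n) X 0 ∈ excursions n ↔ X ∈ excursionUpTo (2 * n) := by
  have hw (i : Fin (2 * n + 1)) : window (2 * n) X 0 i = randomWalk X i := by
    simp [window, randomWalk_zero]
  simp only [excursions, Set.mem_ofPred_eq, window_zero_mem_SW _ hX, true_and, hw, excursionUpTo,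
    Fin.val_last]
  refine and_congr_left fun _ => ⟨fun h i h0 hi => ?_, fun h i h0 hi => ?_⟩
  · exact h ⟨i, by omega⟩ (Fin.lt_def.2 h0) (Fin.lt_def.2 hi)
  · exact h i h0 hi

lemma expectedWaitingTime_excursions (m : ℕ) :
    expectedWaitingTime (excursions (m + 1)) = ENNReal.ofReal (4 * (m + 1) / returnProb m) :=
  expectedWaitingTime_eq_ofReal (upTo_excursionUpTo _)
    (fun _ hX => window_mem_excursions (m + 1) hX) (hasSum_noHit_excursion m)

/-! ### Positive walks -/

/-- The walk is at a weak running minimum at time `m`. -/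
def weakMin (m : ℕ) : Set (ℕ → ℤ) := {X | ∀ k ≤ m, randomWalk X m ≤ randomWalk X k}

lemma upTo_weakMin (m : ℕ) : UpTo m (weakMin m) := fun X Y h hX k hk => by
  rw [← randomWalk_congr h hk, ← randomWalk_congr h le_rfl]; exact hX k hk

lemma exists_last_weakMin (X : ℕ → ℤ) (m : ℕ) : ∃ j ≤ m, X ∈ weakMin j ∧
    ∀ i, j < i → i ≤ m → randomWalk X j < randomWalk X i := by
  induction m with
  | zero => exact ⟨0, le_rfl, fun k hk => by rw [Nat.le_zero.1 hk], fun i h1 h2 => by omega⟩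
  | succ m ih =>
    obtain ⟨j, hj, hmin, hlt⟩ := ih
    by_cases h : randomWalk X (m + 1) ≤ randomWalk X j
    · refine ⟨m + 1, le_rfl, fun k hk => ?_, fun i h1 h2 => by omega⟩
      rcases Nat.le_succ_iff.1 hk with hk | rfl
      · rcases le_or_gt k j with hkj | hkj
        · exact h.trans (hmin k hkj)
        · exact h.trans (hlt k hkj hk).le
      · exact le_rfl
    · refine ⟨j, by omega, hmin, fun i h1 h2 => ?_⟩
      rcases Nat.le_succ_iff.1 h2 with h2 | rfl
      · exact hlt i h1 h2
      · exact not_le.1 h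

lemma shift_mem_positiveUpTo {X : ℕ → ℤ} {j n : ℕ} :
    shiftSteps j X ∈ positiveUpTo n ↔
      ∀ i, j < i → i ≤ j + n → randomWalk X j < randomWalk X i := by
  constructor
  · intro h i h1 h2
    have := h (i - j) (by omega) (by omega)
    rw [randomWalk_shift, show j + (i - j) = i by omega] at this
    omega
  · intro h i h1 h2
    have := h (j + i) (by omega) (by omega)
    rw [randomWalk_shift]
    omega

/-- A positive stretch begun before a weak minimum at `m` cannot extend over `m`. Conversely, if the
last weak minimum up to `m` were at `j < m`, the walk would stay above its height at `j` up to time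
`m + N`, completing a pattern too early. -/
lemma positive_first_iff {N : ℕ} (hN : 0 < N) (m : ℕ) (X : ℕ → ℤ) :
    X ∈ (noHit (positiveUpTo N) N m ∩ weakMin m) ∩ shiftSteps m ⁻¹' positiveUpTo N ↔
      X ∈ noHit (positiveUpTo N) N (m + N - 1) \ noHit (positiveUpTo N) N (m + N) := by
  constructor
  · rintro ⟨⟨h1, h2⟩, h3⟩
    refine ⟨fun j hj hX => ?_, fun h => h m le_rfl h3⟩
    by_cases hjm : j + N ≤ m
    · exact h1 j hjm hX
    · have a := shift_mem_positiveUpTo.1 hX m (by omega) (by omega)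
      have b := h2 j (by omega)
      omega
  · rintro ⟨h1, h2⟩
    have h3 : shiftSteps m X ∈ positiveUpTo N := by
      by_contra h3
      refine h2 fun j hj hX => ?_
      rcases hj.lt_or_eq with hj | hj
      · exact h1 j (by omega) hX
      · obtain rfl : j = m := by omega
        exact h3 hX
    refine ⟨⟨noHit_antitone _ _ (by omega) h1, ?_⟩, h3⟩
    obtain ⟨j, hj, hmin, hlt⟩ := exists_last_weakMin X m
    rcases hj.lt_or_eq with hj | rfl
    · refine absurd (shift_mem_positiveUpTo.2 fun i hi1 hi2 => ?_) (h1 j (by omega))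
      rcases le_or_gt i m with hi | hi
      · exact hlt i hi1 hi
      · exact (hlt m hj le_rfl).trans (shift_mem_positiveUpTo.1 h3 i hi (by omega))
    · exact hmin

/-- Decomposition at the last weak minimum `m - i`. After it the walk is positive for `i` steps, and
`i < N` because otherwise a pattern would have been completed. -/
lemma measureReal_noHit_positive (N m : ℕ) :
    stepsLaw.real (noHit (positiveUpTo N) N m) = ∑ i ∈ Finset.range N,
      if i ≤ m then stepsLaw.real (positiveUpTo i) *
        stepsLaw.real (noHit (positiveUpTo N) N (m - i) ∩ weakMin (m - i)) else 0 := by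
  have hG (j : ℕ) : UpTo j (noHit (positiveUpTo N) N j ∩ weakMin j) :=
    ((upTo_positiveUpTo N).noHit j).inter (upTo_weakMin j)
  rw [← Finset.sum_filter]
  have h1 : ∀ i ∈ (Finset.range N).filter (· ≤ m), stepsLaw.real (positiveUpTo i) *
      stepsLaw.real (noHit (positiveUpTo N) N (m - i) ∩ weakMin (m - i)) =
      stepsLaw.real ((noHit (positiveUpTo N) N (m - i) ∩ weakMin (m - i)) ∩
        shiftSteps (m - i) ⁻¹' positiveUpTo i) := fun i _ => by
    rw [(hG (m - i)).measureReal_inter_shift (upTo_positiveUpTo i).measurableSet, mul_comm]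
  rw [Finset.sum_congr rfl h1, ← measureReal_biUnion_finset]
  · congr 1
    ext X
    simp only [Finset.mem_filter, Finset.mem_range, Set.mem_iUnion, exists_prop]
    constructor
    · intro h
      obtain ⟨j, hj, hmin, hlt⟩ := exists_last_weakMin X m
      have hjN : m - j < N := by
        by_contra hjN
        exact h j (by omega) (shift_mem_positiveUpTo.2 fun i hi1 hi2 => hlt i hi1 (by omega))
      refine ⟨m - j, ⟨hjN, by omega⟩, ?_⟩
      rw [show m - (m - j) = j by omega]
      exact ⟨⟨noHit_antitone _ _ hj h, hmin⟩,
        shift_mem_positiveUpTo.2 fun i hi1 hi2 => hlt i hi1 (by omega)⟩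
    · rintro ⟨i, ⟨hiN, him⟩, ⟨h1, h2⟩, h3⟩ k hk hX
      by_cases hki : k + N ≤ m - i
      · exact h1 k hki hX
      · have a := shift_mem_positiveUpTo.1 hX (m - i) (by omega) (by omega)
        have b := h2 k (by omega)
        omega
  · have key : ∀ i j : ℕ, i < j → j ≤ m → Disjoint
        ((noHit (positiveUpTo N) N (m - i) ∩ weakMin (m - i)) ∩
          shiftSteps (m - i) ⁻¹' positiveUpTo i)
        ((noHit (positiveUpTo N) N (m - j) ∩ weakMin (m - j)) ∩
          shiftSteps (m - j) ⁻¹' positiveUpTo j) := fun i j hij hj => by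
      refine Set.disjoint_left.2 fun X hi hj' => ?_
      have a := hi.1.2 (m - j) (by omega)
      have b := shift_mem_positiveUpTo.1 hj'.2 (m - i) (by omega) (by omega)
      omega
    intro i hi j hj hij
    simp only [Finset.coe_filter, Finset.mem_range, Set.mem_ofPred_eq] at hi hj
    rcases hij.lt_or_gt with h | h
    · exact key i j h hj.2
    · exact (key j i h hi.2).symm
  · intro i _
    exact (hG _).measurableSet.inter
      (measurable_shiftSteps _ (upTo_positiveUpTo i).measurableSet)

lemma hasSum_noHit_positive (n : ℕ) :
    HasSum (fun k => stepsLaw.real (noHit (positiveUpTo (2 * n + 1)) (2 * n + 1) k))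
      (4 * n + 1 + 1 / returnProb n) := by
  set N := 2 * n + 1 with hN
  have hr := returnProb_pos n
  have h := hasSum_of_renewal (p := stepsLaw.real (positiveUpTo N)) (N := N) (R := N)
    (t := fun k => stepsLaw.real (noHit (positiveUpTo N) N k))
    (g := fun k => stepsLaw.real (noHit (positiveUpTo N) N k ∩ weakMin k))
    (q := fun i => stepsLaw.real (positiveUpTo i))
    (by rw [measureReal_positiveUpTo_odd]; positivity) (by omega) (fun _ => measureReal_nonneg)
    (fun _ => measureReal_nonneg) (fun k hk => by simp [noHit_eq_univ _ hk]) ?_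
    (measureReal_noHit_positive N)
  · convert h using 1
    rw [sum_measureReal_positiveUpTo, measureReal_positiveUpTo_odd]
    field_simp
    ring
  · intro k
    have hB := upTo_positiveUpTo N
    rw [← measureReal_diff_noHit hB, mul_comm,
      ← ((hB.noHit k).inter (upTo_weakMin k)).measureReal_inter_shift hB.measurableSet]
    congr 1
    ext X
    exact positive_first_iff (by omega) k X

lemma window_mem_positiveWalks (n : ℕ) {X : ℕ → ℤ} (hX : X ∈ signSteps) :
    window (2 * n + 1) X 0 ∈ positiveWalks n ↔ X ∈ positiveUpTo (2 * n + 1) := by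
  have hw (i : Fin (2 * n + 1 + 1)) : window (2 * n + 1) X 0 i = randomWalk X i := by
    simp [window, randomWalk_zero]
  simp only [positiveWalks, Set.mem_ofPred_eq, window_zero_mem_SW _ hX, true_and, hw, positiveUpTo]
  refine ⟨fun h i h0 hi => ?_, fun h i h0 => ?_⟩
  · exact h ⟨i, by omega⟩ (Fin.lt_def.2 h0)
  · exact h i h0 (by omega)

lemma expectedWaitingTime_positiveWalks (n : ℕ) :
    expectedWaitingTime (positiveWalks n) = ENNReal.ofReal (4 * n + 1 + 1 / returnProb n) :=
  expectedWaitingTime_eq_ofReal (upTo_positiveUpTo _)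
    (fun _ hX => window_mem_positiveWalks n hX) (hasSum_noHit_positive n)

/-! ### Local lower bounds -/

lemma exp_neg_two_mul_le {t : ℝ} (h0 : 0 ≤ t) (h1 : t ≤ 1 / 2) :
    Real.exp (-(2 * t)) ≤ 1 - t := by
  rw [Real.exp_neg, inv_le_iff_one_le_mul₀ (Real.exp_pos _)]
  have h := Real.add_one_le_exp (2 * t)
  nlinarith

lemma le_walkProb_mod_two {n : ℕ} (hn : 1 ≤ n) :
    1 / (2 * √n) ≤ walkProb n ((n % 2 : ℕ) : ℤ) := by
  have hr {m : ℕ} (hm : 1 ≤ m) (hmn : m ≤ n) : 1 / (2 * √n) ≤ returnProb m := by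
    have hs : √(n : ℝ) * √(n : ℝ) = n := Real.mul_self_sqrt (by positivity)
    have hmn' : (m : ℝ) ≤ n := by exact_mod_cast hmn
    have hn' : (0 : ℝ) < n := by positivity
    rw [div_le_iff₀ (by positivity)]
    have h := le_returnProb_sq hm
    have h2 : returnProb m ^ 2 * (4 * m) ≤ (returnProb m * (2 * √n)) ^ 2 := by
      have := sq_nonneg (returnProb m)
      nlinarith
    have h0 : 0 ≤ returnProb m * (2 * √n) := by have := returnProb_pos m; positivity
    nlinarith
  obtain ⟨m, rfl | rfl⟩ := Nat.even_or_odd' n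
  · rw [show 2 * m % 2 = 0 by omega]
    exact hr (by omega) (by omega)
  · rw [show (2 * m + 1) % 2 = 1 by omega, Nat.cast_one, walkProb_two_mul_add_one_one]
    exact hr (by omega) (by omega)

/-- Local limit lower bound for the simple random walk in the range of order `√n`. -/
lemma exists_le_walkProb {A : ℝ} (hA : 0 ≤ A) : ∃ c : ℝ, 0 < c ∧ ∀ᶠ n : ℕ in atTop,
    ∀ x : ℤ, |(x : ℝ)| ≤ A * √n → x ≡ (n : ℤ) [ZMOD 2] → c / √n ≤ walkProb n x := by
  -- With `t = B / √n`, this makes `t * n ≥ 2 * y + 2` for `y ≤ A * √n`, so the ratio `(n - y) / (n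
  -- + y + 2)` is at least `1 - t`.
  set B : ℝ := 2 * A + 2 with hB
  have hB0 : 0 < B := by positivity
  -- At most `A * √n` ratios, each at least `exp (-2 * B / √n)`; the `1 / 2` comes from
  -- `le_walkProb_mod_two`.
  refine ⟨Real.exp (-(2 * A * B)) / 2, by positivity, ?_⟩
  have hev : ∀ᶠ n : ℕ in atTop, 2 * B ≤ √(n : ℝ) :=
    (Real.tendsto_sqrt_atTop.comp tendsto_natCast_atTop_atTop).eventually_ge_atTop _
  filter_upwards [hev, eventually_ge_atTop 1] with n hnB hn x hx hp
  have hn1 : (1 : ℝ) ≤ n := by exact_mod_cast hn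
  have hs1 : 1 ≤ √(n : ℝ) := Real.one_le_sqrt.2 hn1
  have hs0 : 0 < √(n : ℝ) := by linarith
  have hss : √(n : ℝ) * √(n : ℝ) = n := Real.mul_self_sqrt (by positivity)
  set t : ℝ := B / √n with ht
  have ht0 : 0 ≤ t := by positivity
  have ht1 : t ≤ 1 / 2 := by rw [ht, div_le_iff₀ hs0]; linarith
  have hts : t * √n = B := div_mul_cancel₀ _ hs0.ne'
  have hstep {y : ℤ} (hy : 0 ≤ y) (hyA : (y : ℝ) ≤ A * √n) :
      (1 - t) * walkProb n y ≤ walkProb n (y + 2) := by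
    have hy' : (0 : ℝ) ≤ y := by exact_mod_cast hy
    have hpos : (0 : ℝ) < n + y + 2 := by positivity
    refine le_of_mul_le_mul_left ?_ hpos
    rw [walkProb_ratio, ← mul_assoc]
    refine mul_le_mul_of_nonneg_right ?_ (walkProb_nonneg _ _)
    have h1 : t * n = B * √n := by rw [← hts, mul_assoc, hss]
    have h2 : 0 ≤ t * (y + 2) := by positivity
    nlinarith
  have hpow (k : ℕ) (hk : ((n % 2 : ℕ) : ℝ) + 2 * k ≤ A * √n) :
      (1 - t) ^ k * walkProb n ((n % 2 : ℕ) : ℤ) ≤ walkProb n ((n % 2 : ℕ) + 2 * k) := by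
    induction k with
    | zero => simp
    | succ k ih =>
      push_cast at hk
      have hk' : ((n % 2 : ℕ) : ℝ) + 2 * k ≤ A * √n := by linarith
      have h := hstep (y := (n % 2 : ℕ) + 2 * k) (by positivity) (by push_cast; exact hk')
      rw [show ((n % 2 : ℕ) : ℤ) + 2 * ((k + 1 : ℕ) : ℤ) = (n % 2 : ℕ) + 2 * k + 2 by
        push_cast; ring]
      refine le_trans ?_ h
      rw [pow_succ', mul_assoc]
      exact mul_le_mul_of_nonneg_left (ih hk') (by linarith)
  have habs : walkProb n |x| = walkProb n x := by
    rcases abs_choice x with h | h <;> rw [h]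
    exact walkProb_neg n x
  obtain ⟨k, hk⟩ : ∃ k : ℕ, |x| = ((n % 2 : ℕ) : ℤ) + 2 * k := by
    refine ⟨((|x| - (n % 2 : ℕ)) / 2).toNat, ?_⟩
    unfold Int.ModEq at hp
    rcases abs_choice x with h | h <;> have := abs_nonneg x <;> omega
  have hkx : ((n % 2 : ℕ) : ℝ) + 2 * k ≤ A * √n := by
    refine le_trans (le_of_eq ?_) hx
    rw [← Int.cast_abs, hk]
    push_cast
    rfl
  rw [← habs, hk]
  refine le_trans ?_ (hpow k hkx)
  have hk2 : (k : ℝ) ≤ A * √n := by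
    have : (0 : ℝ) ≤ ((n % 2 : ℕ) : ℝ) := by positivity
    have : (0 : ℝ) ≤ k := by positivity
    linarith
  have h1 : Real.exp (-(2 * A * B)) ≤ (1 - t) ^ k := by
    refine le_trans ?_ (pow_le_pow_left₀ (Real.exp_pos _).le (exp_neg_two_mul_le ht0 ht1) k)
    rw [← Real.exp_nat_mul, Real.exp_le_exp]
    have : k * t ≤ A * B := by
      calc k * t ≤ A * √n * t := mul_le_mul_of_nonneg_right hk2 ht0
        _ = A * B := by rw [mul_assoc, mul_comm (√(n : ℝ)), hts]
    linarith
  calc Real.exp (-(2 * A * B)) / 2 / √n = Real.exp (-(2 * A * B)) * (1 / (2 * √n)) := by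
        field_simp
    _ ≤ _ := mul_le_mul h1 (le_walkProb_mod_two hn) (by positivity)
        (pow_nonneg (by linarith) k)

lemma sum_walkProb_le_measureReal {n : ℕ} {s : Finset ℤ} {E : Set (ℕ → ℤ)}
    (h : ∀ X, randomWalk X n ∈ s → X ∈ E) : ∑ x ∈ s, walkProb n x ≤ stepsLaw.real E := by
  simp only [← measureReal_walkAt]
  rw [← measureReal_biUnion_finset]
  · refine measureReal_mono fun X hX => ?_
    simp only [Set.mem_iUnion, exists_prop] at hX
    obtain ⟨x, hx, hX⟩ := hX
    exact h X (by rw [hX]; exact hx)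
  · intro x _ y _ hxy
    exact Set.disjoint_left.2 fun X h1 h2 => hxy (h1.symm.trans h2)
  · exact fun x _ => (upTo_walkAt n x).measurableSet

/-- The walk is above, and below, a level of order `√n` with probability bounded below. -/
lemma exists_le_measureReal_tail {A : ℝ} (hA : 0 ≤ A) : ∃ c : ℝ, 0 < c ∧ ∀ᶠ n : ℕ in atTop,
    ∀ x : ℤ, |(x : ℝ)| ≤ A * √n → x ≡ (n : ℤ) [ZMOD 2] →
      c ≤ stepsLaw.real {X | randomWalk X n ≤ x} ∧ c ≤ stepsLaw.real {X | x ≤ randomWalk X n} := by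
  -- The sites `x ± 2 * i` with `i ≤ √n` stay within `(A + 2) * √n`. On either side there are at
  -- least `√n` of them, each of probability at least `c / √n`.
  obtain ⟨c, hc, h⟩ := exists_le_walkProb (A := A + 2) (by positivity)
  refine ⟨c, hc, ?_⟩
  filter_upwards [h, eventually_ge_atTop 1] with n hn hn1 x hx hp
  have hs0 : 0 < √(n : ℝ) := Real.sqrt_pos.2 (by positivity)
  have key (e : ℤ) (he : |e| = 1) {E : Set (ℕ → ℤ)}
      (hE : ∀ X, ∀ i : ℕ, randomWalk X n = x + e * (2 * i) → X ∈ E) : c ≤ stepsLaw.real E := by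
    have he0 : e ≠ 0 := by rintro rfl; simp at he
    have hinj : Function.Injective fun i : ℕ => x + e * (2 * (i : ℤ)) := fun i j hij => by
      have := mul_left_cancel₀ he0 (add_left_cancel hij)
      omega
    have h1 := sum_walkProb_le_measureReal (n := n)
      (s := (Finset.range (⌊√(n : ℝ)⌋₊ + 1)).map ⟨_, hinj⟩) (E := E) fun X hX => by
        simp only [Finset.mem_map, Function.Embedding.coeFn_mk] at hX
        obtain ⟨i, _, hi⟩ := hX
        exact hE X i hi.symm
    refine le_trans ?_ h1
    rw [Finset.sum_map]
    have h2 : ∑ _i ∈ Finset.range (⌊√(n : ℝ)⌋₊ + 1), c / √n ≤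
        ∑ i ∈ Finset.range (⌊√(n : ℝ)⌋₊ + 1), walkProb n (x + e * (2 * (i : ℤ))) := by
      refine Finset.sum_le_sum fun i hi => hn _ ?_ ?_
      · have hi' : (i : ℝ) ≤ √n :=
          (Nat.le_floor_iff hs0.le).1 (Nat.lt_succ_iff.1 (Finset.mem_range.1 hi))
        have he' : |(e : ℝ)| = 1 := by exact_mod_cast he
        have h3 : |(e : ℝ) * (2 * i)| = 2 * i := by
          rw [abs_mul, he', one_mul, abs_of_nonneg (by positivity)]
        push_cast
        refine (abs_add_le _ _).trans ?_
        rw [h3]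
        linarith
      · refine Int.ModEq.trans ?_ hp
        unfold Int.ModEq
        rw [show e * (2 * (i : ℤ)) = 2 * (e * i) by ring]
        omega
    refine le_trans ?_ h2
    rw [Finset.sum_const, Finset.card_range, nsmul_eq_mul, mul_div_assoc', le_div_iff₀ hs0,
      mul_comm]
    refine mul_le_mul_of_nonneg_right ?_ hc.le
    push_cast
    exact (Nat.lt_floor_add_one _).le
  refine ⟨key (-1) (by simp) fun X i hi => ?_, key 1 (by simp) fun X i hi => ?_⟩
  · change randomWalk X n ≤ x
    omega
  · change x ≤ randomWalk X n
    omega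

/-! ### Parity and size of the level -/

lemma level_parity (l : ℝ) (n : ℕ) : level l n ≡ (n : ℤ) [ZMOD 2] := by
  unfold level
  split_ifs with h
  · exact h
  · unfold Int.ModEq at *
    omega

lemma level_mem_Ioc (l : ℝ) (n : ℕ) : (level l n : ℝ) ∈ Set.Ioc (l * √n - 1) (l * √n + 1) := by
  have h1 := Int.floor_le (l * √(n : ℝ))
  have h2 := Int.lt_floor_add_one (l * √(n : ℝ))
  unfold level
  split_ifs
  · exact ⟨by linarith, by linarith⟩
  · push_cast
    exact ⟨by linarith, by linarith⟩

lemma abs_level_le (l : ℝ) {n : ℕ} (hn : 1 ≤ n) : |(level l n : ℝ)| ≤ (|l| + 1) * √n := by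
  have hs1 : 1 ≤ √(n : ℝ) := Real.one_le_sqrt.2 (by exact_mod_cast hn)
  obtain ⟨h1, h2⟩ := level_mem_Ioc l n
  have h3 : l * √n ≤ |l| * √n := mul_le_mul_of_nonneg_right (le_abs_self l) (by positivity)
  have h4 : -l * √n ≤ |l| * √n := mul_le_mul_of_nonneg_right (neg_le_abs l) (by positivity)
  rw [abs_le]
  constructor <;> nlinarith

/-! ### Upper bounds by independent trials -/

/-- Dropping the occurrences that straddle time `a` leaves two independent events. -/
lemma measureReal_noHit_add_le {B : Set (ℕ → ℤ)} {N : ℕ} (hB : UpTo N B) (a b : ℕ) :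
    stepsLaw.real (noHit B N (a + b)) ≤
      stepsLaw.real (noHit B N a) * stepsLaw.real (noHit B N b) := by
  rw [← (hB.noHit a).measureReal_inter_shift (hB.noHit b).measurableSet]
  refine measureReal_mono fun X hX => ⟨noHit_antitone _ _ (by omega) hX, fun k hk h => ?_⟩
  refine hX (a + k) (by omega) ?_
  convert h using 1
  ext i
  simp only [shiftSteps, add_assoc]

lemma expectedWaitingTime_le {n : ℕ} {A : Set (Fin (n + 1) → ℤ)} {B : Set (ℕ → ℤ)}
    (hB : UpTo n B) (hAB : ∀ X ∈ signSteps, window n X 0 ∈ A ↔ X ∈ B) {M : ℕ} (hM : 0 < M) {c : ℝ}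
    (hc : 0 < c) (h : stepsLaw.real (noHit B n M) ≤ 1 - c) :
    expectedWaitingTime A ≤ ENNReal.ofReal (M / c) := by
  have hc1 : 0 ≤ 1 - c := measureReal_nonneg.trans h
  have hpow (K : ℕ) : stepsLaw.real (noHit B n (K * M)) ≤ (1 - c) ^ K := by
    induction K with
    | zero => simp
    | succ K ih =>
      rw [add_mul, one_mul, pow_succ]
      exact (measureReal_noHit_add_le hB _ _).trans (mul_le_mul ih h measureReal_nonneg
        (pow_nonneg hc1 K))
  -- Block number `K` contributes at most `M * (1 - c) ^ K`; the bound is the geometric sum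
  -- multiplied by `c`.
  have hsum (K : ℕ) : c * ∑ m ∈ Finset.range (K * M), stepsLaw.real (noHit B n m) ≤
      M * (1 - (1 - c) ^ K) := by
    induction K with
    | zero => simp
    | succ K ih =>
      rw [add_mul, one_mul, Finset.sum_range_add, mul_add]
      have h1 : ∑ i ∈ Finset.range M, stepsLaw.real (noHit B n (K * M + i)) ≤
          ∑ _i ∈ Finset.range M, (1 - c) ^ K :=
        Finset.sum_le_sum fun i _ =>
          (measureReal_mono (noHit_antitone B n (Nat.le_add_right _ _))).trans (hpow K)
      rw [Finset.sum_const, Finset.card_range, nsmul_eq_mul] at h1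
      have h2 := mul_le_mul_of_nonneg_left h1 hc.le
      rw [pow_succ]
      nlinarith
  rw [expectedWaitingTime_eq_tsum hB hAB]
  refine ENNReal.tsum_le_of_sum_range_le fun K => ?_
  rw [← ENNReal.ofReal_sum_of_nonneg fun _ _ => measureReal_nonneg]
  refine ENNReal.ofReal_le_ofReal ?_
  rw [le_div_iff₀ hc, mul_comm]
  calc c * ∑ m ∈ Finset.range K, stepsLaw.real (noHit B n m)
      ≤ c * ∑ m ∈ Finset.range (K * M), stepsLaw.real (noHit B n m) := by
        refine mul_le_mul_of_nonneg_left (Finset.sum_le_sum_of_subset_of_nonneg ?_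
          fun _ _ _ => measureReal_nonneg) hc.le
        exact Finset.range_subset_range.2 (Nat.le_mul_of_pos_right K hM)
    _ ≤ M * (1 - (1 - c) ^ K) := hsum K
    _ ≤ M := mul_le_of_le_one_right (by positivity) (by have := pow_nonneg hc1 K; linarith)

/-! ### Bridges -/

/-- A discrete intermediate value theorem: within one parity class, an increase of at most two
cannot jump over `x`. -/
lemma exists_eq_of_even_steps {Y : ℕ → ℤ} {x : ℤ} {n : ℕ} (hp : ∀ k, Y k ≡ x [ZMOD 2])
    (hY : ∀ k, Y (k + 1) ≤ Y k + 2) (h0 : Y 0 ≤ x) (hn : x ≤ Y n) : ∃ k ≤ n, Y k = x := by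
  induction n with
  | zero => exact ⟨0, le_rfl, le_antisymm h0 hn⟩
  | succ n ih =>
    rcases le_or_gt x (Y n) with h | h
    · obtain ⟨k, hk, hkx⟩ := ih h
      exact ⟨k, by omega, hkx⟩
    · refine ⟨n + 1, le_rfl, ?_⟩
      have h1 := hp n
      have h2 := hp (n + 1)
      have h3 := hY n
      unfold Int.ModEq at h1 h2
      omega

lemma walkAt_hit_of_crossing {X : ℕ → ℤ} (hX : X ∈ signSteps) {n : ℕ} {x : ℤ}
    (hp : x ≡ (n : ℤ) [ZMOD 2]) (h0 : randomWalk X n ≤ x)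
    (h1 : x ≤ randomWalk (shiftSteps n X) n) : X ∉ noHit (walkAt n x) n (2 * n) := by
  obtain ⟨k, hk, hkx⟩ := exists_eq_of_even_steps (n := n) (x := x)
    (Y := fun k => randomWalk (shiftSteps k X) n)
    (fun k => (randomWalk_parity (shiftSteps_mem_signSteps hX k) n).trans hp.symm)
    (fun k => by
      simp only [randomWalk_shift]
      rw [show k + 1 + n = k + n + 1 by ring]
      rcases randomWalk_step hX k with h | h <;> rcases randomWalk_step hX (k + n) with h' | h' <;>
        omega)
    (by simpa [randomWalk_shift, randomWalk_zero] using h0) h1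
  exact fun h => h k (by omega) hkx

lemma window_mem_bridges (l : ℝ) (n : ℕ) {X : ℕ → ℤ} (hX : X ∈ signSteps) :
    window n X 0 ∈ bridges l n ↔ X ∈ walkAt n (level l n) := by
  simp only [bridges, Set.mem_ofPred_eq, window_zero_mem_SW _ hX, true_and, walkAt]
  simp [window, randomWalk_zero]

lemma exists_expectedWaitingTime_bridges_le (l : ℝ) : ∃ C : ℝ, 0 < C ∧ ∀ᶠ n : ℕ in atTop,
    expectedWaitingTime (bridges l n) ≤ ENNReal.ofReal (C * n) := by
  obtain ⟨c, hc, h⟩ := exists_le_measureReal_tail (A := |l| + 1) (by positivity)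
  -- Blocks of length `2 * n`, each successful with probability at least `c ^ 2`.
  refine ⟨2 / c ^ 2, by positivity, ?_⟩
  filter_upwards [h, eventually_ge_atTop 1] with n hn hn1
  obtain ⟨h1, h2⟩ := hn (level l n) (abs_level_le l hn1) (level_parity l n)
  have hB := upTo_walkAt n (level l n)
  have hle : UpTo n {X | randomWalk X n ≤ level l n} := fun X Y hXY hX => by
    rw [Set.mem_ofPred_eq, ← randomWalk_congr hXY le_rfl]; exact hX
  have hge : UpTo n {X | level l n ≤ randomWalk X n} := fun X Y hXY hX => by
    rw [Set.mem_ofPred_eq, ← randomWalk_congr hXY le_rfl]; exact hX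
  have h3 : c ^ 2 ≤ stepsLaw.real (noHit (walkAt n (level l n)) n (2 * n))ᶜ := by
    calc c ^ 2 ≤ stepsLaw.real {X | randomWalk X n ≤ level l n} *
          stepsLaw.real {X | level l n ≤ randomWalk X n} := by
          rw [sq]; exact mul_le_mul h1 h2 hc.le measureReal_nonneg
      _ = _ := (hle.measureReal_inter_shift hge.measurableSet).symm
      _ ≤ _ := measureReal_mono_signSteps fun X hX hX' =>
          walkAt_hit_of_crossing hX (level_parity l n) hX'.1 hX'.2
  rw [probReal_compl_eq_one_sub (hB.noHit _).measurableSet] at h3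
  have h4 := expectedWaitingTime_le hB (fun _ hX => window_mem_bridges l n hX)
    (M := 2 * n) (by omega) (c := c ^ 2) (by positivity) (by linarith)
  convert h4 using 2
  push_cast
  ring

/-! ### First passage walks -/

/-- Second moment method. -/
lemma le_measureReal_biUnion {E : ℕ → Set (ℕ → ℤ)} (hE : ∀ k, MeasurableSet (E k)) (n : ℕ)
    (t : ℝ) :
    2 * t * ∑ k ∈ Finset.range n, stepsLaw.real (E k) -
      t ^ 2 * ∑ k ∈ Finset.range n, ∑ l ∈ Finset.range n, stepsLaw.real (E k ∩ E l) ≤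
    stepsLaw.real (⋃ k ∈ Finset.range n, E k) := by
  have hU : MeasurableSet (⋃ k ∈ Finset.range n, E k) :=
    Finset.measurableSet_biUnion _ fun k _ => hE k
  have hint {F : Set (ℕ → ℤ)} (hF : MeasurableSet F) :
      Integrable (F.indicator (1 : (ℕ → ℤ) → ℝ)) stepsLaw :=
    (integrable_const (1 : ℝ)).indicator hF
  have h1 : ∑ k ∈ Finset.range n, stepsLaw.real (E k) =
      ∫ X, ∑ k ∈ Finset.range n, (E k).indicator (1 : (ℕ → ℤ) → ℝ) X ∂stepsLaw := by
    rw [integral_finsetSum _ fun k _ => hint (hE k)]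
    exact Finset.sum_congr rfl fun k _ => (integral_indicator_one (hE k)).symm
  have hint2 (k : ℕ) : Integrable
      (fun X => ∑ l ∈ Finset.range n, (E k ∩ E l).indicator (1 : (ℕ → ℤ) → ℝ) X) stepsLaw :=
    integrable_finsetSum _ fun l _ => hint ((hE k).inter (hE l))
  have h2 : ∑ k ∈ Finset.range n, ∑ l ∈ Finset.range n, stepsLaw.real (E k ∩ E l) =
      ∫ X, ∑ k ∈ Finset.range n, ∑ l ∈ Finset.range n,
        (E k ∩ E l).indicator (1 : (ℕ → ℤ) → ℝ) X ∂stepsLaw := by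
    rw [integral_finsetSum _ fun k _ => hint2 k]
    refine Finset.sum_congr rfl fun k _ => ?_
    rw [integral_finsetSum _ fun l _ => hint ((hE k).inter (hE l))]
    exact Finset.sum_congr rfl fun l _ => (integral_indicator_one ((hE k).inter (hE l))).symm
  have i1 : Integrable (fun X => 2 * t * ∑ k ∈ Finset.range n,
      (E k).indicator (1 : (ℕ → ℤ) → ℝ) X) stepsLaw :=
    (integrable_finsetSum _ fun k _ => hint (hE k)).const_mul _
  have i2 : Integrable (fun X => t ^ 2 * ∑ k ∈ Finset.range n, ∑ l ∈ Finset.range n,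
      (E k ∩ E l).indicator (1 : (ℕ → ℤ) → ℝ) X) stepsLaw :=
    (integrable_finsetSum _ fun k _ => hint2 k).const_mul _
  rw [h1, h2, ← integral_indicator_one hU, ← integral_const_mul, ← integral_const_mul,
    ← integral_sub i1 i2]
  refine integral_mono (i1.sub i2) (hint hU) fun X => ?_
  simp only [Set.inter_indicator_one, Pi.mul_apply]
  rw [← Finset.sum_mul_sum]
  set S := ∑ k ∈ Finset.range n, (E k).indicator (1 : (ℕ → ℤ) → ℝ) X
  by_cases hX : X ∈ ⋃ k ∈ Finset.range n, E k
  · rw [Set.indicator_of_mem hX, Pi.one_apply]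
    -- Pointwise, `2 * t * S - t ^ 2 * S ^ 2 = 1 - (1 - t * S) ^ 2 ≤ 1`.
    nlinarith [sq_nonneg (1 - t * S)]
  · have hS : S = 0 := Finset.sum_eq_zero fun k hk => Set.indicator_of_notMem (fun h => hX (by
      simp only [Set.mem_iUnion, exists_prop]
      exact ⟨k, hk, h⟩)) _
    rw [Set.indicator_of_notMem hX, hS]
    simp

lemma shiftSteps_shiftSteps (a b : ℕ) (X : ℕ → ℤ) :
    shiftSteps a (shiftSteps b X) = shiftSteps (b + a) X :=
  funext fun i => by simp only [shiftSteps, add_assoc]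

/-- Two first passages starting at times `0` and `j` split into three independent pieces. -/
lemma measureReal_firstHit_inter_shift_le {n j : ℕ} (hj : 0 < j) (hjn : j < n) (x : ℤ) :
    stepsLaw.real (firstHit n x ∩ shiftSteps j ⁻¹' firstHit n x) ≤
      ∑ s ∈ Finset.Icc (1 : ℤ) j, walkProb j s * (hitProb (n - j) (x - s) * hitProb j s) := by
  have hterm (s : ℤ) : walkProb j s * (hitProb (n - j) (x - s) * hitProb j s) =
      stepsLaw.real (walkAt j (-s) ∩ shiftSteps j ⁻¹'
        (firstHit (n - j) (x - s) ∩ shiftSteps (n - j) ⁻¹' firstHit j s)) := by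
    have hB := (upTo_firstHit j s).measurableSet
    rw [(upTo_walkAt j (-s)).measureReal_inter_shift
      ((upTo_firstHit _ _).measurableSet.inter (measurable_shiftSteps _ hB)),
      (upTo_firstHit _ _).measureReal_inter_shift hB, measureReal_walkAt, measureReal_firstHit,
      measureReal_firstHit, walkProb_neg]
  simp only [hterm]
  refine le_trans (measureReal_mono_signSteps fun X hX hX' => ?_) (measureReal_biUnion_finset_le _ _)
  obtain ⟨⟨h1, h2⟩, h3, h4⟩ := hX'
  -- At time `n` the second passage is not yet finished, while the walk is at `-x`; this forces the
  -- walk to be negative at time `j`, so the summation index starts at `1`.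
  have hlt := h4 (n - j) (by omega)
  simp only [randomWalk_shift, show j + (n - j) = n by omega] at h3 hlt
  have hb := (randomWalk_bounds hX j).1
  simp only [Set.mem_iUnion, exists_prop]
  refine ⟨-randomWalk X j, Finset.mem_Icc.2 ⟨by omega, by omega⟩, ?_, ⟨?_, fun i hi => ?_⟩, ?_,
    fun i hi => ?_⟩
  · change randomWalk X j = _
    omega
  · rw [randomWalk_shift, show j + (n - j) = n by omega]
    omega
  · have := h2 (j + i) (by omega)
    rw [randomWalk_shift]
    omega
  · rw [randomWalk_shift, randomWalk_shift, randomWalk_shift,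
      show j + (n - j + j) = j + n by omega, show j + (n - j) = n by omega]
    omega
  · have := h4 (n - j + i) (by omega)
    rw [randomWalk_shift, show j + (n - j + i) = n + i by omega] at this
    rw [randomWalk_shift, randomWalk_shift, randomWalk_shift,
      show j + (n - j + i) = n + i by omega, show j + (n - j) = n by omega]
    omega

/-- The longer of the two passages, of lengths `j` and `n - j`, has probability at most `2 / n`. The
free piece and the sum over `s` of the shorter passage each contribute one inverse square root of
the shorter length. -/
lemma measureReal_firstHit_overlap_le {n j : ℕ} (hj : 0 < j) (hjn : j < n) (x : ℤ) :
    stepsLaw.real (firstHit n x ∩ shiftSteps j ⁻¹' firstHit n x) ≤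
      2 / n * (1 / j + 1 / (n - j : ℕ)) := by
  refine (measureReal_firstHit_inter_shift_le hj hjn x).trans ?_
  have hk : 0 < n - j := by omega
  set k := n - j with hkdef
  have hj0 : (0 : ℝ) < j := by exact_mod_cast hj
  have hk0 : (0 : ℝ) < k := by exact_mod_cast hk
  have hn0 : (0 : ℝ) < n := by exact_mod_cast (by omega : 0 < n)
  have hnk : (n : ℝ) = j + k := by exact_mod_cast (by omega : n = j + k)
  have hw (s : ℤ) : walkProb j s ≤ 1 / √j :=
    (walkProb_le j s).trans (one_div_le_one_div_of_le (Real.sqrt_pos.2 hj0)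
      (Real.sqrt_le_sqrt (by linarith)))
  have hsj : √(j : ℝ) * √(j : ℝ) = j := Real.mul_self_sqrt hj0.le
  have hsk : √(k : ℝ) * √(k : ℝ) = k := Real.mul_self_sqrt hk0.le
  have hpos1 : 0 ≤ 2 / (n : ℝ) * (1 / k) := by positivity
  have hpos2 : 0 ≤ 2 / (n : ℝ) * (1 / j) := by positivity
  rw [mul_add]
  rcases le_total j k with hjk | hkj
  · have hjk' : (j : ℝ) ≤ k := by exact_mod_cast hjk
    have h1 : 1 / (k : ℝ) ≤ 2 / n := by
      rw [div_le_div_iff₀ hk0 hn0]; linarith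
    calc _ ≤ ∑ s ∈ Finset.Icc (1 : ℤ) j, 1 / √(j : ℝ) * (2 / n * hitProb j s) :=
          Finset.sum_le_sum fun s _ => mul_le_mul (hw s) (mul_le_mul_of_nonneg_right
            ((hitProb_le (by omega) _).trans h1) (hitProb_nonneg _ _))
            (mul_nonneg (hitProb_nonneg _ _) (hitProb_nonneg _ _)) (by positivity)
      _ = 1 / √(j : ℝ) * (2 / n * ∑ s ∈ Finset.Icc (1 : ℤ) j, hitProb j s) := by
          rw [Finset.mul_sum, Finset.mul_sum]
      _ ≤ 1 / √(j : ℝ) * (2 / n * (1 / √j)) := by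
          have := sum_hitProb_le (n := j) (by omega) (Finset.Icc (1 : ℤ) j)
          gcongr
      _ = 2 / n * (1 / j) := by
          rw [mul_left_comm, div_mul_div_comm, hsj, one_mul]
      _ ≤ _ := by linarith
  · have hkj' : (k : ℝ) ≤ j := by exact_mod_cast hkj
    have h1 : 1 / (j : ℝ) ≤ 2 / n := by
      rw [div_le_div_iff₀ hj0 hn0]; linarith
    have hinj : Function.Injective fun s : ℤ => x - s := fun s t h => by
      simp only at h; omega
    have hsum := sum_hitProb_le (n := k) (by omega) ((Finset.Icc (1 : ℤ) j).map ⟨_, hinj⟩)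
    rw [Finset.sum_map] at hsum
    simp only [Function.Embedding.coeFn_mk] at hsum
    calc _ ≤ ∑ s ∈ Finset.Icc (1 : ℤ) j, 1 / √(k : ℝ) * (2 / n * hitProb k (x - s)) :=
          Finset.sum_le_sum fun s _ => by
            rw [mul_comm (2 / (n : ℝ))]
            refine mul_le_mul ((hw s).trans ?_) (mul_le_mul_of_nonneg_left
              ((hitProb_le (by omega) _).trans h1) (hitProb_nonneg _ _))
              (mul_nonneg (hitProb_nonneg _ _) (hitProb_nonneg _ _)) (by positivity)
            exact one_div_le_one_div_of_le (Real.sqrt_pos.2 hk0) (Real.sqrt_le_sqrt hkj')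
      _ = 1 / √(k : ℝ) * (2 / n * ∑ s ∈ Finset.Icc (1 : ℤ) j, hitProb k (x - s)) := by
          rw [Finset.mul_sum, Finset.mul_sum]
      _ ≤ 1 / √(k : ℝ) * (2 / n * (1 / √k)) := by gcongr
      _ = 2 / n * (1 / k) := by
          rw [mul_left_comm, div_mul_div_comm, hsk, one_mul]
      _ ≤ _ := by linarith

/-- Lag `0` contributes `1 / n`, and the other lags two harmonic sums with factor `2 / n`. -/
lemma sum_measureReal_firstHit_overlap_le {n : ℕ} (hn : 1 ≤ n) (x : ℤ) :
    ∑ j ∈ Finset.range n, stepsLaw.real (firstHit n x ∩ shiftSteps j ⁻¹' firstHit n x) ≤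
      (5 + 4 * Real.log n) / n := by
  have hn0 : (0 : ℝ) < n := by exact_mod_cast hn
  obtain ⟨m, rfl⟩ : ∃ m, n = m + 1 := ⟨n - 1, by omega⟩
  set n := m + 1 with hnm
  rw [Finset.sum_range_succ']
  have h0 : stepsLaw.real (firstHit n x ∩ shiftSteps 0 ⁻¹' firstHit n x) ≤ 1 / n :=
    (measureReal_mono Set.inter_subset_left).trans
      ((measureReal_firstHit n x).trans_le (hitProb_le (by omega) x))
  have hH : ∑ i ∈ Finset.range m, 1 / ((i + 1 : ℕ) : ℝ) ≤ 1 + Real.log n := by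
    have h := harmonic_le_one_add_log m
    simp only [harmonic, Rat.cast_sum, Rat.cast_inv, Rat.cast_natCast] at h
    have h2 : Real.log m ≤ Real.log n := by
      rcases Nat.eq_zero_or_pos m with h0 | h0
      · simp only [h0, Nat.cast_zero, Real.log_zero]
        exact Real.log_nonneg (by exact_mod_cast hn)
      · exact Real.log_le_log (by exact_mod_cast h0) (by exact_mod_cast Nat.le_succ m)
    simp only [one_div]
    linarith
  have hH2 : ∑ i ∈ Finset.range m, 1 / ((n - (i + 1) : ℕ) : ℝ) =
      ∑ i ∈ Finset.range m, 1 / ((i + 1 : ℕ) : ℝ) := by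
    rw [← Finset.sum_range_reflect]
    refine Finset.sum_congr rfl fun i hi => ?_
    have := Finset.mem_range.1 hi
    rw [show n - (m - 1 - i + 1) = i + 1 by omega]
  have h1 : ∑ i ∈ Finset.range m,
      stepsLaw.real (firstHit n x ∩ shiftSteps (i + 1) ⁻¹' firstHit n x) ≤
      ∑ i ∈ Finset.range m, 2 / (n : ℝ) * (1 / ((i + 1 : ℕ) : ℝ) + 1 / ((n - (i + 1) : ℕ) : ℝ)) :=
    Finset.sum_le_sum fun i hi => measureReal_firstHit_overlap_le (by omega)
      (by have := Finset.mem_range.1 hi; omega) x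
  rw [← Finset.mul_sum, Finset.sum_add_distrib, hH2] at h1
  have h2 := mul_le_mul_of_nonneg_left hH (by positivity : 0 ≤ 4 / (n : ℝ))
  have e : (5 + 4 * Real.log n) / n = 1 / n + 4 / n * (1 + Real.log n) := by ring
  rw [e]
  have e2 : 2 / (n : ℝ) * (∑ i ∈ Finset.range m, 1 / ((i + 1 : ℕ) : ℝ) +
      ∑ i ∈ Finset.range m, 1 / ((i + 1 : ℕ) : ℝ)) =
      4 / n * ∑ i ∈ Finset.range m, 1 / ((i + 1 : ℕ) : ℝ) := by ring
  rw [e2] at h1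
  linarith

/-- By stationarity a term depends only on the lag `|k - l|`, and for fixed `k` each lag occurs at
most twice. -/
lemma sum_sum_measureReal_shift_inter_le {B : Set (ℕ → ℤ)} (hB : MeasurableSet B) (n : ℕ) :
    ∑ k ∈ Finset.range n, ∑ l ∈ Finset.range n,
      stepsLaw.real (shiftSteps k ⁻¹' B ∩ shiftSteps l ⁻¹' B) ≤
    n * (2 * ∑ j ∈ Finset.range n, stepsLaw.real (B ∩ shiftSteps j ⁻¹' B)) := by
  set f : ℕ → ℝ := fun j => stepsLaw.real (B ∩ shiftSteps j ⁻¹' B) with hf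
  have hf0 (j : ℕ) : 0 ≤ f j := measureReal_nonneg
  have hpair (k j : ℕ) :
      stepsLaw.real (shiftSteps k ⁻¹' B ∩ shiftSteps (k + j) ⁻¹' B) = f j := by
    simp only [hf]
    rw [← measureReal_shift k (hB.inter (measurable_shiftSteps j hB))]
    congr 1
    ext X
    simp only [Set.mem_inter_iff, Set.mem_preimage, shiftSteps_shiftSteps]
  rw [← nsmul_eq_mul]
  conv_rhs => rw [← Finset.card_range n]
  refine Finset.sum_le_card_nsmul _ _ _ fun k hk => ?_
  rw [Finset.card_range]
  have hkn := Finset.mem_range.1 hk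
  obtain ⟨m, rfl⟩ : ∃ m, n = k + m := ⟨n - k, by omega⟩
  rw [Finset.sum_range_add, two_mul]
  have hsub {a b : ℕ} (hab : a ≤ b) : ∑ i ∈ Finset.range a, f i ≤ ∑ i ∈ Finset.range b, f i :=
    Finset.sum_le_sum_of_subset_of_nonneg (Finset.range_subset_range.2 hab) fun i _ _ => hf0 i
  refine add_le_add ?_ ?_
  · rw [← Finset.sum_range_reflect]
    calc _ = ∑ i ∈ Finset.range k, f (i + 1) := by
          refine Finset.sum_congr rfl fun i hi => ?_
          have := Finset.mem_range.1 hi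
          rw [← hpair (k - 1 - i) (i + 1), Set.inter_comm, show k - 1 - i + (i + 1) = k by omega]
      _ ≤ ∑ i ∈ Finset.range (k + 1), f i := by
          rw [Finset.sum_range_succ']
          linarith [hf0 0]
      _ ≤ _ := hsub (by omega)
  · simp only [hpair]
    exact hsub (by omega)

lemma window_mem_firstPassageWalks (l : ℝ) (n : ℕ) {X : ℕ → ℤ} (hX : X ∈ signSteps) :
    window n X 0 ∈ firstPassageWalks l n ↔ X ∈ firstHit n (-level l n) := by
  have hw (i : Fin (n + 1)) : window n X 0 i = randomWalk X i := by
    simp [window, randomWalk_zero]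
  simp only [firstPassageWalks, Set.mem_ofPred_eq, window_zero_mem_SW _ hX, true_and, hw, firstHit,
    Fin.val_last, neg_neg]
  rw [and_comm]
  refine and_congr_right fun h => ⟨fun h' i hi => ?_, fun h' i hi => ?_⟩
  · rw [← h]
    exact h' ⟨i, by omega⟩ (Fin.lt_def.2 hi)
  · rw [h]
    exact h' i hi

lemma exists_expectedWaitingTime_firstPassageWalks_le {l : ℝ} (hl : l < 0) :
    ∃ C : ℝ, 0 < C ∧ ∀ᶠ n : ℕ in atTop, expectedWaitingTime (firstPassageWalks l n) ≤
      ENNReal.ofReal (C * (n : ℝ) ^ (5 / 4 : ℝ)) := by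
  obtain ⟨c, hc, h⟩ := exists_le_walkProb (A := |l| + 1) (by positivity)
  set c₀ : ℝ := c * (-l / 2) with hc₀
  have hc₀pos : 0 < c₀ := mul_pos hc (by linarith)
  -- Then the rounding error `1` in the level is at most half of `-l * √n`.
  have hev : ∀ᶠ n : ℕ in atTop, 2 / -l ≤ √(n : ℝ) :=
    (Real.tendsto_sqrt_atTop.comp tendsto_natCast_atTop_atTop).eventually_ge_atTop _
  refine ⟨84 / c₀ ^ 2, by positivity, ?_⟩
  filter_upwards [h, hev, eventually_ge_atTop 1] with n hn hnl hn1
  have hn1' : (1 : ℝ) ≤ n := by exact_mod_cast hn1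
  have hs0 : 0 < √(n : ℝ) := Real.sqrt_pos.2 (by linarith)
  set x : ℤ := -level l n with hx
  have hB := upTo_firstHit n x
  have hxlow : -l / 2 * √n ≤ x := by
    have h1 := (level_mem_Ioc l n).2
    rw [div_le_iff₀ (by linarith)] at hnl
    rw [hx]
    push_cast
    linarith
  have hx0 : (0 : ℝ) ≤ x := le_trans (mul_nonneg (by linarith) hs0.le) hxlow
  have hwalk : c / √n ≤ walkProb n x := by
    rw [hx, walkProb_neg]
    exact hn _ (abs_level_le l hn1) (level_parity l n)
  have hfirst : c₀ ≤ n * hitProb n x := by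
    rw [hitProb_eq n (by exact_mod_cast hx0)]
    calc c₀ = -l / 2 * √n * (c / √n) := by rw [hc₀]; field_simp
      _ ≤ x * walkProb n x := mul_le_mul hxlow hwalk (by positivity) hx0
  -- The second moment is at most `2 * (5 + 4 * log n)`, and `log n ≤ 4 * n ^ (1 / 4)` turns this
  -- into `10 + 32 = 42` times the power. With blocks of length `2 * n` this gives the final `84`.
  set D : ℝ := 42 * (n : ℝ) ^ (1 / 4 : ℝ) with hD
  have hDpos : 0 < D := by positivity
  have hpow1 : 1 ≤ (n : ℝ) ^ (1 / 4 : ℝ) := Real.one_le_rpow hn1' (by norm_num)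
  have hlog : Real.log n ≤ 4 * (n : ℝ) ^ (1 / 4 : ℝ) := by
    have := Real.log_le_rpow_div (x := n) (by linarith) (ε := 1 / 4) (by norm_num)
    linarith
  set E : ℕ → Set (ℕ → ℤ) := fun k => shiftSteps k ⁻¹' firstHit n x with hE
  have hEm (k : ℕ) : MeasurableSet (E k) := measurable_shiftSteps k hB.measurableSet
  have hS1 : ∑ k ∈ Finset.range n, stepsLaw.real (E k) = n * hitProb n x := by
    simp only [hE, measureReal_shift _ hB.measurableSet, measureReal_firstHit]
    simp
  have hS2 : ∑ k ∈ Finset.range n, ∑ l ∈ Finset.range n, stepsLaw.real (E k ∩ E l) ≤ D := by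
    refine (sum_sum_measureReal_shift_inter_le hB.measurableSet n).trans ?_
    have h1 := sum_measureReal_firstHit_overlap_le hn1 x
    rw [le_div_iff₀ (by linarith)] at h1
    linarith
  -- This choice of `t` maximizes `2 * t * c₀ - t ^ 2 * D`.
  have hU := le_measureReal_biUnion hEm n (c₀ / D)
  rw [hS1] at hU
  have hhit : c₀ ^ 2 / D ≤ stepsLaw.real (noHit (firstHit n x) n (2 * n))ᶜ := by
    calc c₀ ^ 2 / D = 2 * (c₀ / D) * c₀ - (c₀ / D) ^ 2 * D := by field_simp; ring
      _ ≤ 2 * (c₀ / D) * (n * hitProb n x) - (c₀ / D) ^ 2 *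
          ∑ k ∈ Finset.range n, ∑ l ∈ Finset.range n, stepsLaw.real (E k ∩ E l) := by gcongr
      _ ≤ _ := hU
      _ ≤ stepsLaw.real (noHit (firstHit n x) n (2 * n))ᶜ := measureReal_mono fun X hX hX' => by
          simp only [Set.mem_iUnion, exists_prop, Finset.mem_range] at hX
          obtain ⟨k, hk, hX⟩ := hX
          exact hX' k (by omega) hX
  rw [probReal_compl_eq_one_sub (hB.noHit _).measurableSet] at hhit
  have h4 := expectedWaitingTime_le hB (fun _ hX => window_mem_firstPassageWalks l n hX)
    (M := 2 * n) (by omega) (c := c₀ ^ 2 / D) (by positivity) (by linarith)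
  convert h4 using 2
  have hp : (n : ℝ) ^ (5 / 4 : ℝ) = n * (n : ℝ) ^ (1 / 4 : ℝ) := by
    rw [show (5 / 4 : ℝ) = 1 + 1 / 4 by norm_num, Real.rpow_add (by linarith), Real.rpow_one]
  rw [hp, hD]
  push_cast
  field_simp
  ring

/-! ### Asymptotics -/

lemma tendsto_sqrt_mul_returnProb :
    Tendsto (fun m : ℕ => √(m : ℝ) * returnProb m) atTop (𝓝 (1 / √Real.pi)) := by
  have h1 : Tendsto (fun m : ℕ => ((2 : ℝ) + 1 / (m : ℝ))) atTop (𝓝 (2 + 0)) :=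
    tendsto_const_nhds.add tendsto_one_div_atTop_nhds_zero_nat
  have h2 : Tendsto (fun m : ℕ => returnProb m * √(2 * m + 1) / √((2 : ℝ) + 1 / (m : ℝ))) atTop
      (𝓝 (√(2 / Real.pi) / √(2 + 0))) :=
    tendsto_returnProb_mul_sqrt.div h1.sqrt (by positivity)
  have e : √(2 / Real.pi) / √(2 + 0) = 1 / √Real.pi := by
    rw [add_zero, Real.sqrt_div zero_le_two]
    field_simp
  rw [e] at h2
  refine h2.congr' ?_
  filter_upwards [eventually_ge_atTop 1] with m hm
  have hm0 : (0 : ℝ) < m := by exact_mod_cast hm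
  rw [div_eq_iff (by positivity), show 2 * (m : ℝ) + 1 = m * (2 + 1 / m) by field_simp,
    Real.sqrt_mul hm0.le]
  ring

lemma excursions_asymptotics :
    (∀ᶠ n : ℕ in atTop, expectedWaitingTime (excursions n) ≠ ⊤) ∧
      (fun n : ℕ => (expectedWaitingTime (excursions n)).toReal) ~[atTop]
        (fun n : ℕ => 4 * √Real.pi * (n : ℝ) ^ (3 / 2 : ℝ)) := by
  have he : ∀ᶠ n : ℕ in atTop, ∃ m, n = m + 1 ∧
      expectedWaitingTime (excursions n) = ENNReal.ofReal (4 * (m + 1) / returnProb m) := by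
    filter_upwards [eventually_ge_atTop 1] with n hn
    obtain ⟨m, rfl⟩ : ∃ m, n = m + 1 := ⟨n - 1, by omega⟩
    exact ⟨m, rfl, expectedWaitingTime_excursions m⟩
  refine ⟨he.mono fun n ⟨m, _, h⟩ => by rw [h]; exact ENNReal.ofReal_ne_top, ?_⟩
  rw [isEquivalent_iff_tendsto_one (by
    filter_upwards [eventually_ge_atTop 1] with n hn
    positivity)]
  -- The exact formula for excursions of length `2 * (m + 1)` involves `returnProb m`, hence the
  -- index shift and the factor `(m + 1) / m` tending to `1`.
  rw [← tendsto_add_atTop_iff_nat 1]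
  have h1 : Tendsto (fun m : ℕ => ((m + 1 : ℕ) : ℝ) / m) atTop (𝓝 1) := by
    have := (tendsto_const_nhds (x := (1 : ℝ))).add tendsto_one_div_atTop_nhds_zero_nat
    rw [add_zero] at this
    refine this.congr' ?_
    filter_upwards [eventually_ge_atTop 1] with m hm
    push_cast
    field_simp
  have h2 := (((tendsto_sqrt_mul_returnProb.mul h1.sqrt).mul_const √Real.pi).inv₀
    (by rw [Real.sqrt_one]; positivity))
  have e : (1 / √Real.pi * √1 * √Real.pi)⁻¹ = 1 := by
    have : √Real.pi ≠ 0 := by positivity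
    field_simp
    simp
  rw [e] at h2
  refine h2.congr' ?_
  filter_upwards [eventually_ge_atTop 1] with m hm
  have hr := returnProb_pos m
  have hm0 : (0 : ℝ) < m := by exact_mod_cast hm
  have hp : ((m + 1 : ℕ) : ℝ) ^ (3 / 2 : ℝ) = ((m + 1 : ℕ) : ℝ) * √((m + 1 : ℕ) : ℝ) := by
    rw [show (3 / 2 : ℝ) = 1 + 1 / 2 by norm_num, Real.rpow_add (by positivity), Real.rpow_one,
      Real.sqrt_eq_rpow]
  simp only [Pi.div_apply]
  rw [expectedWaitingTime_excursions, ENNReal.toReal_ofReal (by positivity), hp,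
    Real.sqrt_div (by positivity)]
  push_cast
  field_simp

lemma positiveWalks_asymptotics :
    (∀ᶠ n : ℕ in atTop, expectedWaitingTime (positiveWalks n) ≠ ⊤) ∧
      (fun n : ℕ => (expectedWaitingTime (positiveWalks n)).toReal) ~[atTop]
        (fun n : ℕ => 4 * (n : ℝ)) := by
  refine ⟨.of_forall fun n => by
    rw [expectedWaitingTime_positiveWalks]; exact ENNReal.ofReal_ne_top, ?_⟩
  rw [isEquivalent_iff_tendsto_one (by
    filter_upwards [eventually_ge_atTop 1] with n hn
    positivity)]
  have h0 : Tendsto (fun n : ℕ => 1 / (n : ℝ)) atTop (𝓝 0) := tendsto_one_div_atTop_nhds_zero_nat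
  have h1 := (tendsto_sqrt_mul_returnProb.inv₀ (by positivity)).mul h0.sqrt
  have h2 := ((tendsto_const_nhds (x := (1 : ℝ))).add (h0.const_mul (1 / 4))).add
    (h1.const_mul (1 / 4))
  simp only [Real.sqrt_zero, mul_zero, add_zero] at h2
  refine h2.congr' ?_
  filter_upwards [eventually_ge_atTop 1] with n hn
  have hr := returnProb_pos n
  have hn0 : (0 : ℝ) < n := by exact_mod_cast hn
  have hs : √(n : ℝ) * √(n : ℝ) = n := Real.mul_self_sqrt hn0.le
  simp only [Pi.div_apply]
  rw [expectedWaitingTime_positiveWalks, ENNReal.toReal_ofReal (by positivity),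
    Real.sqrt_div zero_le_one, Real.sqrt_one]
  have e : (√(n : ℝ) * returnProb n)⁻¹ * (1 / √n) = 1 / (n * returnProb n) := by
    rw [← one_div, div_mul_div_comm, one_mul, mul_right_comm, hs]
  rw [e]
  field_simp

theorem theorem1p5 :
    -- excursions
    ((∀ᶠ n : ℕ in atTop, expectedWaitingTime (excursions n) ≠ ⊤) ∧
      (fun n : ℕ => (expectedWaitingTime (excursions n)).toReal) ~[atTop]
        (fun n : ℕ => 4 * √Real.pi * (n : ℝ) ^ (3 / 2 : ℝ))) ∧
    -- positive walks
    ((∀ᶠ n : ℕ in atTop, expectedWaitingTime (positiveWalks n) ≠ ⊤) ∧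
      (fun n : ℕ => (expectedWaitingTime (positiveWalks n)).toReal) ~[atTop]
        (fun n : ℕ => 4 * (n : ℝ))) ∧
    -- bridges
    (∀ l : ℝ, ∃ c C : ℝ, 0 < c ∧ 0 < C ∧ ∀ᶠ n : ℕ in atTop,
      ENNReal.ofReal (c * n) ≤ expectedWaitingTime (bridges l n) ∧
      expectedWaitingTime (bridges l n) ≤ ENNReal.ofReal (C * n)) ∧
    -- first passage walks
    (∀ l : ℝ, l < 0 → ∃ c C : ℝ, 0 < c ∧ 0 < C ∧ ∀ᶠ n : ℕ in atTop,
      ENNReal.ofReal (c * n) ≤ expectedWaitingTime (firstPassageWalks l n) ∧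
      expectedWaitingTime (firstPassageWalks l n) ≤
        ENNReal.ofReal (C * (n : ℝ) ^ (5 / 4 : ℝ))) := by
  refine ⟨excursions_asymptotics, positiveWalks_asymptotics, fun l => ?_, fun l hl => ?_⟩
  · obtain ⟨C, hC, h⟩ := exists_expectedWaitingTime_bridges_le l
    refine ⟨1, C, one_pos, hC, h.mono fun n hn => ⟨?_, hn⟩⟩
    rw [one_mul, ENNReal.ofReal_natCast]
    exact le_expectedWaitingTime _
  · obtain ⟨C, hC, h⟩ := exists_expectedWaitingTime_firstPassageWalks_le hl
    refine ⟨1, C, one_pos, hC, h.mono fun n hn => ⟨?_, hn⟩⟩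
    rw [one_mul, ENNReal.ofReal_natCast]
    exact le_expectedWaitingTime _
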